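/- Norm inflation for the three-dimensional Boussinesq system on $\mathbb T^3=(\mathbb R/2\pi\mathbb Z)^3$, $$u_t-\Delta u+u\cdot\nabla u+\nabla\pi=\rho e_3,\qquad \rho_t-\Delta\rho+u\cdot\nabla\rho=0,\qquad \nabla\cdot u=0,\qquad e_3=(0,0,1).$$ For $s>0$ let $\|f\|_{\dot B^{-s}_{\infty,\infty}}=\sup_{t>0}t^{s/2}\|e^{t\Delta}f\|_{L^\infty}$. There is $\epsilon_0>0$ such that for every $0<\epsilon<\epsilon_0$ there exist a time $0<T<\epsilon$ and a smooth space-periodic solution $(u,\rho)$ of the system on $[0,T]\times\mathbb T^3$, with smooth space-periodic pressure $\pi$, such that $$\|u(0)\|_{\dot B^{-1}_{\infty,\infty}}+\|\rho(0)\|_{\dot B^{-1}_{\infty,\infty}}<\epsilon$$ and $$\|\rho(T)\|_{\dot B^{-s}_{\infty,\infty}}>\frac1\epsilon\qquad\text{for all } s>0.$$ Here "smooth" means that $u$, $\rho$ and $\pi$ are $C^\infty$ on $[0,T]\times\mathbb T^3$, including at the end points of the time interval. -/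

import Mathlib

open scoped ContDiff ENNReal

namespace Boussinesq

/-- Three-dimensional Euclidean space. Functions on the torus `𝕋³ = (ℝ / 2πℤ)³` are functions on
this space that are `2π`-periodic in each coordinate. -/
abbrev E3 : Type := EuclideanSpace ℝ (Fin 3)

/-- The `i`-th unit vector. -/
noncomputable def unitVec (i : Fin 3) : E3 := EuclideanSpace.single i (1 : ℝ)

/-- `f` is `2π`-periodic in each coordinate. -/
def SpacePeriodic {F : Type*} (f : E3 → F) : Prop :=
  ∀ (i : Fin 3) (x : E3), f (x + (2 * Real.pi) • unitVec i) = f x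

/-- The divergence `∑ᵢ ∂ᵢ vᵢ` of a vector field. -/
noncomputable def divergence (v : E3 → E3) (x : E3) : ℝ :=
  ∑ i : Fin 3, (fderiv ℝ v x (unitVec i)) i

/-- The heat semigroup `e^{tΔ} f` for `t > 0`, as convolution with the Gaussian kernel
`(4πt)^{-3/2} exp(-|x-y|²/(4t))`. On bounded measurable periodic `f` it is the heat semigroup of
the torus. -/
noncomputable def heat {F : Type*} [NormedAddCommGroup F] [NormedSpace ℝ F]
    (t : ℝ) (f : E3 → F) (x : E3) : F :=
  ∫ y : E3, ((4 * Real.pi * t) ^ (-(3 / 2) : ℝ) * Real.exp (-‖x - y‖ ^ 2 / (4 * t))) • f y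

/-- The homogeneous Besov norm
`‖f‖_{Ḃ^{-s}_{∞,∞}} = sup_{t>0} t^{s/2} ‖e^{tΔ} f‖_{L^∞}`, for `s > 0`, with values in
`[0, ∞]`. -/
noncomputable def besovNorm {F : Type*} [NormedAddCommGroup F] [NormedSpace ℝ F]
    (s : ℝ) (f : E3 → F) : ℝ≥0∞ :=
  ⨆ (t : ℝ) (_ : 0 < t),
    ENNReal.ofReal (t ^ (s / 2)) * MeasureTheory.eLpNorm (heat t f) ⊤ MeasureTheory.volume

/-- `(u, ρ)` with pressure `p` is a smooth space-periodic solution on the time interval `[0, T]`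
of the Boussinesq system
`∂ₜu - Δu + u·∇u + ∇p = ρ e₃`, `∂ₜρ - Δρ + u·∇ρ = 0`, `∇·u = 0`.
All of `u`, `ρ`, `p` are smooth up to the initial and final times; time derivatives at the two end
points are one-sided. -/
structure IsSmoothPeriodicSolution (T : ℝ) (u : ℝ → E3 → E3) (ρ : ℝ → E3 → ℝ)
    (p : ℝ → E3 → ℝ) : Prop where
  smooth_u : ContDiffOn ℝ ∞ (fun z : ℝ × E3 => u z.1 z.2) (Set.Icc 0 T ×ˢ Set.univ)
  smooth_ρ : ContDiffOn ℝ ∞ (fun z : ℝ × E3 => ρ z.1 z.2) (Set.Icc 0 T ×ˢ Set.univ)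
  smooth_p : ContDiffOn ℝ ∞ (fun z : ℝ × E3 => p z.1 z.2) (Set.Icc 0 T ×ˢ Set.univ)
  periodic_u : ∀ t ∈ Set.Icc 0 T, SpacePeriodic (u t)
  periodic_ρ : ∀ t ∈ Set.Icc 0 T, SpacePeriodic (ρ t)
  periodic_p : ∀ t ∈ Set.Icc 0 T, SpacePeriodic (p t)
  momentum : ∀ t ∈ Set.Icc 0 T, ∀ x : E3,
    derivWithin (fun τ => u τ x) (Set.Icc 0 T) t - Laplacian.laplacian (u t) x
      + fderiv ℝ (u t) x (u t x) + gradient (p t) x = ρ t x • unitVec 2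
  transport : ∀ t ∈ Set.Icc 0 T, ∀ x : E3,
    derivWithin (fun τ => ρ τ x) (Set.Icc 0 T) t - Laplacian.laplacian (ρ t) x
      + fderiv ℝ (ρ t) x (u t x) = 0
  incompressible : ∀ t ∈ Set.Icc 0 T, ∀ x : E3, divergence (u t) x = 0

end Boussinesq

/-!
The proof rests on an exact solution that reduces the system to a linear problem. Let `w` be a
shear profile depending on `(t, x₁)` and solving the heat equation, and let `ρ` depend on
`(t, x₁, x₂)` and solve `∂ₜρ - Δρ + w ∂₂ρ = 0`. Then `u = (0, w, tρ)` with zero pressure solves the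
Boussinesq system, since `(∂ₜ - Δ + w ∂₂)(tρ) = ρ` and all other nonlinear terms vanish
(`isSmoothPeriodicSolution_of_shear`).

Put `ρ = Re ∑ₙ gₙ(t) exp (i (n x₁ + x₂))` and start from `w = κ ∑ⱼ kⱼ cos (kⱼ x₁)` and
`ρ = κ cos x₂ ∑ⱼ kⱼ cos (kⱼ x₁)` with `r` lacunary frequencies `kⱼ = K 2ʲ`. Both have norm at most
`4 κ` in `Ḃ^{-1}_{∞,∞}`, whatever `r` is (`sum_lacunary_le`). The coefficients solve a linear system
of ordinary differential equations, whose solution is a Dyson series (`density`); it converges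
factorially in the space of sequences with weight `exp |n|` (`norm_dyson_le`), and the equation then
gives smoothness in space and time (`smoothFamily_density`). At first order, each pair of equal
frequencies feeds about `κ² / 4` into the mode `n = 0` within a time of order `K⁻²`, so that this
mode reaches the size `r κ² / 4` (`dyson_one_zero`). The higher orders carry powers of the
`L¹`-in-time norm of `w`, at most `r κ / K`, and so are negligible for large `K`
(`norm_density_zero_sub_le`). Choosing `κ` small, then `r` large, then `K` large gives small data
and a large lowest mode by the time `ε / 2`. Evaluating the heat flow at time `1` shows that a large
lowest mode makes all Besov norms large at once (`lt_besovNorm_densityField`).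

The solution is taken from a small positive time `δ` of the series on, so that smoothness up to the
initial time follows from smoothness on an open set of times. At time `δ` the data differ from the
free heat flow by an error that tends to zero with `δ` in `ℓ¹` (`norm_density_sub_le`).
-/

namespace Boussinesq

open MeasureTheory

/-! ### Plane waves and the heat semigroup -/

/-- The plane wave `x ↦ exp (i ⟪ν, x⟫)`. -/
noncomputable def wave (ν x : E3) : ℂ :=
  Complex.exp (((inner ℝ ν x : ℝ) : ℂ) * Complex.I)

@[simp] lemma norm_wave (ν x : E3) : ‖wave ν x‖ = 1 :=
  Complex.norm_exp_ofReal_mul_I _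

lemma wave_add_left (ν μ x : E3) : wave (ν + μ) x = wave ν x * wave μ x := by
  simp only [wave, ← Complex.exp_add, inner_add_left]
  congr 1
  push_cast
  ring

lemma wave_add_right (ν x y : E3) : wave ν (x + y) = wave ν x * wave ν y := by
  simp only [wave, ← Complex.exp_add, inner_add_right]
  congr 1
  push_cast
  ring

@[fun_prop] lemma continuous_wave (ν : E3) : Continuous (wave ν) := by
  unfold wave
  fun_prop

/-- The Gaussian kernel of the heat semigroup at time `t`. -/
noncomputable def heatKernel (t : ℝ) (z : E3) : ℝ :=
  (4 * Real.pi * t) ^ (-(3 / 2) : ℝ) * Real.exp (-‖z‖ ^ 2 / (4 * t))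

lemma heat_eq {F : Type*} [NormedAddCommGroup F] [NormedSpace ℝ F] (t : ℝ) (f : E3 → F) (x : E3) :
    heat t f x = ∫ y : E3, heatKernel t (x - y) • f y := rfl

lemma heatKernel_nonneg {t : ℝ} (ht : 0 < t) (z : E3) : 0 ≤ heatKernel t z := by
  unfold heatKernel
  positivity

/-- The Gaussian kernel times a plane wave, in the form of Mathlib's Gaussian integrals. -/
lemma heatKernel_mul_wave {t : ℝ} (ν z : E3) :
    (heatKernel t z : ℂ) * wave ν z = (((4 * Real.pi * t) ^ (-(3 / 2) : ℝ) : ℝ) : ℂ) *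
      Complex.exp (-((1 / (4 * t) : ℝ) : ℂ) * ‖z‖ ^ 2 + Complex.I * (inner ℝ ν z : ℝ)) := by
  unfold heatKernel wave
  push_cast
  rw [mul_assoc, ← Complex.exp_add]
  congr 2
  ring

lemma integrable_heatKernel_mul_wave {t : ℝ} (ht : 0 < t) (ν : E3) :
    Integrable fun z : E3 => (heatKernel t z : ℂ) * wave ν z := by
  simp only [heatKernel_mul_wave]
  refine Integrable.const_mul ?_ _
  apply GaussianFourier.integrable_cexp_neg_mul_sq_norm_add
  rw [Complex.ofReal_re]
  positivity

lemma integrable_heatKernel {t : ℝ} (ht : 0 < t) : Integrable (heatKernel t) := by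
  have h := (integrable_heatKernel_mul_wave ht 0).re
  simpa [wave] using h

/-- The Fourier transform of the heat kernel. -/
lemma integral_heatKernel_mul_wave {t : ℝ} (ht : 0 < t) (ν : E3) :
    ∫ z : E3, (heatKernel t z : ℂ) * wave ν z = (Real.exp (-t * ‖ν‖ ^ 2) : ℂ) := by
  simp only [heatKernel_mul_wave]
  rw [integral_const_mul, GaussianFourier.integral_cexp_neg_mul_sq_norm_add
    (by rw [Complex.ofReal_re]; positivity)]
  have h1 : ((Real.pi : ℂ) / ((1 / (4 * t) : ℝ) : ℂ)) ^ ((Module.finrank ℝ E3 : ℂ) / 2)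
      = (((4 * Real.pi * t) ^ (3 / 2 : ℝ) : ℝ) : ℂ) := by
    rw [Complex.ofReal_cpow (by positivity)]
    congr 1
    · push_cast
      field_simp
    · simp
  rw [h1, ← mul_assoc, ← Complex.ofReal_mul, ← Real.rpow_add (by positivity)]
  simp only [neg_add_cancel, Real.rpow_zero, Complex.ofReal_one, one_mul]
  push_cast
  congr 1
  have : (t : ℂ) ≠ 0 := by exact_mod_cast ht.ne'
  rw [Complex.I_sq]
  field_simp

lemma integral_heatKernel {t : ℝ} (ht : 0 < t) : ∫ z : E3, heatKernel t z = 1 := by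
  have h := integral_heatKernel_mul_wave ht 0
  simp only [wave, inner_zero_left, Complex.ofReal_zero, zero_mul, Complex.exp_zero, mul_one,
    norm_zero, ne_eq, OfNat.ofNat_ne_zero, not_false_eq_true, zero_pow, mul_zero, Real.exp_zero]
    at h
  rw [integral_complex_ofReal] at h
  exact_mod_cast h

lemma integrable_heatKernel_smul {F : Type*} [NormedAddCommGroup F] [NormedSpace ℝ F]
    {t : ℝ} (ht : 0 < t) (x : E3) {f : E3 → F} {C : ℝ} (hf : AEStronglyMeasurable f volume)
    (hC : ∀ y, ‖f y‖ ≤ C) : Integrable fun y : E3 => heatKernel t (x - y) • f y := by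
  refine ((integrable_heatKernel ht).comp_sub_left x).smul_bdd C hf (.of_forall hC)

lemma heat_wave {t : ℝ} (ht : 0 < t) (ν x : E3) :
    heat t (wave ν) x = (Real.exp (-t * ‖ν‖ ^ 2) : ℂ) * wave ν x := by
  rw [heat_eq, ← integral_sub_left_eq_self _ _ x]
  simp only [sub_sub_cancel, Complex.real_smul]
  have h1 : ∀ y, (heatKernel t y : ℂ) * wave ν (x - y)
      = ((heatKernel t y : ℂ) * wave (-ν) y) * wave ν x := fun y => by
    have : wave ν (-y) = wave (-ν) y := by simp [wave]
    rw [sub_eq_add_neg, wave_add_right, this]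
    ring
  simp only [h1]
  rw [integral_mul_const, integral_heatKernel_mul_wave ht, norm_neg]

section Series

variable {ι : Type*}

/-- The Fourier series `∑ᵢ cᵢ exp (i ⟪νᵢ, x⟫)` with frequencies `ν`. -/
noncomputable def series (ν : ι → E3) (c : ι → ℂ) (x : E3) : ℂ := ∑' i, c i * wave (ν i) x

lemma summable_series (ν : ι → E3) {c : ι → ℂ} (hc : Summable fun i => ‖c i‖) (x : E3) :
    Summable fun i => c i * wave (ν i) x :=
  .of_norm (by simpa using hc)

lemma norm_series_le (ν : ι → E3) {c : ι → ℂ} (hc : Summable fun i => ‖c i‖) (x : E3) :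
    ‖series ν c x‖ ≤ ∑' i, ‖c i‖ := by
  have h := norm_tsum_le_tsum_norm (f := fun i => c i * wave (ν i) x) (by simpa using hc)
  simpa [series] using h

lemma continuous_series (ν : ι → E3) {c : ι → ℂ} (hc : Summable fun i => ‖c i‖) :
    Continuous (series ν c) :=
  continuous_tsum (fun i => by fun_prop) hc fun i x => by simp

lemma summable_heat_coeff (ν : ι → E3) {c : ι → ℂ} (hc : Summable fun i => ‖c i‖) {t : ℝ}
    (ht : 0 < t) : Summable fun i => ‖c i * (Real.exp (-t * ‖ν i‖ ^ 2) : ℂ)‖ := by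
  refine hc.of_nonneg_of_le (fun _ => norm_nonneg _) fun i => ?_
  rw [norm_mul, Complex.norm_real, Real.norm_of_nonneg (Real.exp_nonneg _)]
  refine mul_le_of_le_one_right (norm_nonneg _) (Real.exp_le_one_iff.2 ?_)
  nlinarith [sq_nonneg ‖ν i‖]

lemma heat_series [Countable ι] (ν : ι → E3) {c : ι → ℂ} (hc : Summable fun i => ‖c i‖) {t : ℝ}
    (ht : 0 < t) (x : E3) :
    heat t (series ν c) x = series ν (fun i => c i * (Real.exp (-t * ‖ν i‖ ^ 2) : ℂ)) x := by
  have hint : ∀ i, Integrable fun y : E3 => heatKernel t (x - y) • (c i * wave (ν i) y) :=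
    fun i => integrable_heatKernel_smul ht x (C := ‖c i‖) (by fun_prop) (by simp)
  have hn : ∀ i, ∫ y : E3, ‖heatKernel t (x - y) • (c i * wave (ν i) y)‖ = ‖c i‖ := by
    intro i
    simp only [norm_smul, norm_mul, norm_wave, mul_one, Real.norm_of_nonneg (heatKernel_nonneg ht _)]
    rw [integral_mul_const, integral_sub_left_eq_self (fun y => heatKernel t y) volume x,
      integral_heatKernel ht, one_mul]
  have h := hasSum_integral_of_summable_integral_norm hint (by simpa only [hn] using hc)
  have h2 : ∀ i, ∫ y : E3, heatKernel t (x - y) • (c i * wave (ν i) y)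
      = c i * (Real.exp (-t * ‖ν i‖ ^ 2) : ℂ) * wave (ν i) x := by
    intro i
    have := heat_wave ht (ν i) x
    rw [heat_eq] at this
    rw [mul_assoc, ← this, ← integral_const_mul]
    congr 1
    ext y
    simp only [Complex.real_smul]
    ring
  simp only [h2] at h
  rw [heat_eq, series, h.tsum_eq]
  congr 1
  ext y
  rw [series, tsum_const_smul'']

lemma heat_re {t : ℝ} (ht : 0 < t) {f : E3 → ℂ} {C : ℝ} (hf : Continuous f)
    (hC : ∀ y, ‖f y‖ ≤ C) (x : E3) : heat t (fun y => (f y).re) x = (heat t f x).re := by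
  rw [heat_eq, heat_eq]
  have h := Complex.reCLM.integral_comp_comm
    (integrable_heatKernel_smul ht x hf.aestronglyMeasurable hC)
  simpa using h

/-- The heat flow of the real part of a Fourier series. -/
lemma heat_series_re [Countable ι] (ν : ι → E3) {c : ι → ℂ} (hc : Summable fun i => ‖c i‖) {t : ℝ}
    (ht : 0 < t) (x : E3) : heat t (fun y => (series ν c y).re) x
      = (series ν (fun i => c i * (Real.exp (-t * ‖ν i‖ ^ 2) : ℂ)) x).re := by
  rw [heat_re ht (continuous_series ν hc) (norm_series_le ν hc), heat_series ν hc ht]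

lemma besovNorm_le_of_forall {F : Type*} [NormedAddCommGroup F] [NormedSpace ℝ F] {s : ℝ}
    {f : E3 → F} {C : ℝ} (h : ∀ t, 0 < t → ∀ x, t ^ (s / 2) * ‖heat t f x‖ ≤ C) :
    besovNorm s f ≤ ENNReal.ofReal C := by
  refine iSup₂_le fun t ht => ?_
  have hp : 0 < t ^ (s / 2) := Real.rpow_pos_of_pos ht _
  have hb : eLpNorm (heat t f) ⊤ volume ≤ ENNReal.ofReal (C / t ^ (s / 2)) := by
    rw [eLpNorm_exponent_top]
    refine eLpNormEssSup_le_of_ae_bound (.of_forall fun x => ?_)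
    rw [le_div_iff₀ hp, mul_comm]
    exact h t ht x
  calc _ ≤ ENNReal.ofReal (t ^ (s / 2)) * ENNReal.ofReal (C / t ^ (s / 2)) := by gcongr
    _ = ENNReal.ofReal C := by
      rw [← ENNReal.ofReal_mul hp.le, mul_div_cancel₀ _ hp.ne']

/-- Evaluating at the heat time `t = 1` bounds all the Besov norms from below at once. -/
lemma le_besovNorm_of_continuous {f : E3 → ℝ} (s : ℝ) (hc : Continuous (heat 1 f)) (x : E3) :
    ENNReal.ofReal |heat 1 f x| ≤ besovNorm s f := by
  refine le_trans ?_ (le_iSup₂ (f := fun (t : ℝ) (_ : 0 < t) =>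
    ENNReal.ofReal (t ^ (s / 2)) * eLpNorm (heat t f) ⊤ volume) 1 one_pos)
  simp only [Real.one_rpow, ENNReal.ofReal_one, one_mul, eLpNorm_exponent_top]
  -- the essential supremum of a continuous function bounds each of its values
  have h : (fun y => ‖heat 1 f y‖ₑ) ≤ᵐ[volume]
      fun _ => eLpNormEssSup (heat 1 f) volume := ae_le_eLpNormEssSup
  have hcl : IsClosed {y | ‖heat 1 f y‖ₑ ≤ eLpNormEssSup (heat 1 f) volume} :=
    isClosed_le hc.enorm continuous_const
  have hd : Dense {y | ‖heat 1 f y‖ₑ ≤ eLpNormEssSup (heat 1 f) volume} :=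
    Measure.dense_of_ae h
  have hx : x ∈ {y | ‖heat 1 f y‖ₑ ≤ eLpNormEssSup (heat 1 f) volume} := by
    rw [← hcl.closure_eq]
    exact hd x
  simpa [Real.enorm_eq_ofReal_abs] using hx

end Series

/-! ### Space-time smoothness of Fourier series -/

section Smooth

variable {ι : Type*}

/-- The coefficients `cᵢ(t)` decay faster than every power of the frequency, uniformly for
`t ∈ I`. Decay is expressed by summable majorants, so that no lattice sum is needed. -/
def RapidDecay (I : Set ℝ) (ν : ι → E3) (c : ι → ℝ → ℂ) : Prop :=
  ∀ j : ℕ, ∃ C : ι → ℝ, Summable C ∧ ∀ i, ∀ t ∈ I, (1 + ‖ν i‖) ^ j * ‖c i t‖ ≤ C i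

/-- The coefficients `cᵢ(t)` and their first `N` time derivatives are continuous and decay
rapidly on `I`. -/
def SmoothFamily (I : Set ℝ) (ν : ι → E3) : ℕ → (ι → ℝ → ℂ) → Prop
  | 0, c => RapidDecay I ν c ∧ ∀ i, ContinuousOn (c i) I
  | N + 1, c => RapidDecay I ν c ∧ ∃ c' : ι → ℝ → ℂ,
      (∀ i, ∀ t ∈ I, HasDerivAt (c i) (c' i t) t) ∧ SmoothFamily I ν N c'

variable {I : Set ℝ} {ν : ι → E3}

lemma RapidDecay.exists_summable {c : ι → ℝ → ℂ} (h : RapidDecay I ν c) :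
    ∃ C : ι → ℝ, Summable C ∧ ∀ i, ∀ t ∈ I, ‖c i t‖ ≤ C i := by
  simpa using h 0

lemma RapidDecay.summable_norm {c : ι → ℝ → ℂ} (h : RapidDecay I ν c) {t : ℝ} (ht : t ∈ I) :
    Summable fun i => ‖c i t‖ := by
  obtain ⟨C, hC, hb⟩ := h.exists_summable
  exact hC.of_nonneg_of_le (fun _ => norm_nonneg _) fun i => hb i t ht

lemma SmoothFamily.rapidDecay {N : ℕ} {c : ι → ℝ → ℂ} (h : SmoothFamily I ν N c) :
    RapidDecay I ν c := by
  cases N <;> exact h.1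

lemma SmoothFamily.of_succ {N : ℕ} {c : ι → ℝ → ℂ} (h : SmoothFamily I ν (N + 1) c) :
    SmoothFamily I ν N c := by
  induction N generalizing c with
  | zero =>
    obtain ⟨h1, c', h2, -⟩ := h
    exact ⟨h1, fun i t ht => (h2 i t ht).continuousAt.continuousWithinAt⟩
  | succ N ih =>
    obtain ⟨h1, c', h2, h3⟩ := h
    exact ⟨h1, c', h2, ih h3⟩

lemma RapidDecay.mul {c : ι → ℝ → ℂ} (h : RapidDecay I ν c) {m : ι → ℝ → ℂ} {D : ℝ} {p : ℕ}
    (hm : ∀ i, ∀ t ∈ I, ‖m i t‖ ≤ D * (1 + ‖ν i‖) ^ p) :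
    RapidDecay I ν fun i t => m i t * c i t := by
  intro j
  obtain ⟨C, hC, hb⟩ := h (j + p)
  refine ⟨fun i => |D| * C i, hC.mul_left _, fun i t ht => ?_⟩
  have h1 : ‖m i t‖ ≤ |D| * (1 + ‖ν i‖) ^ p :=
    (hm i t ht).trans (by gcongr; exact le_abs_self D)
  rw [norm_mul]
  calc (1 + ‖ν i‖) ^ j * (‖m i t‖ * ‖c i t‖)
      ≤ (1 + ‖ν i‖) ^ j * (|D| * (1 + ‖ν i‖) ^ p * ‖c i t‖) := by gcongr
    _ = |D| * ((1 + ‖ν i‖) ^ (j + p) * ‖c i t‖) := by ring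
    _ ≤ |D| * C i := by gcongr; exact hb i t ht

lemma RapidDecay.add {c d : ι → ℝ → ℂ} (hc : RapidDecay I ν c) (hd : RapidDecay I ν d) :
    RapidDecay I ν fun i t => c i t + d i t := by
  intro j
  obtain ⟨C, hC, hb⟩ := hc j
  obtain ⟨D, hD, hb'⟩ := hd j
  refine ⟨fun i => C i + D i, hC.add hD, fun i t ht => ?_⟩
  calc _ ≤ (1 + ‖ν i‖) ^ j * (‖c i t‖ + ‖d i t‖) := by gcongr; exact norm_add_le _ _
    _ ≤ _ := by rw [mul_add]; exact add_le_add (hb i t ht) (hb' i t ht)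

lemma RapidDecay.reindex {c : ι → ℝ → ℂ} (h : RapidDecay I ν c) (e : ι ≃ ι) {D : ℝ}
    (he : ∀ i, 1 + ‖ν i‖ ≤ D * (1 + ‖ν (e i)‖)) : RapidDecay I ν fun i => c (e i) := by
  intro j
  obtain ⟨C, hC, hb⟩ := h j
  refine ⟨fun i => |D| ^ j * C (e i), ((e.summable_iff (f := C)).2 hC).mul_left _,
    fun i t ht => ?_⟩
  have h1 : 1 + ‖ν i‖ ≤ |D| * (1 + ‖ν (e i)‖) :=
    (he i).trans (by gcongr; exact le_abs_self D)
  calc (1 + ‖ν i‖) ^ j * ‖c (e i) t‖ ≤ (|D| * (1 + ‖ν (e i)‖)) ^ j * ‖c (e i) t‖ := by gcongr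
    _ = |D| ^ j * ((1 + ‖ν (e i)‖) ^ j * ‖c (e i) t‖) := by rw [mul_pow]; ring
    _ ≤ |D| ^ j * C (e i) := by gcongr; exact hb (e i) t ht

lemma SmoothFamily.add {N : ℕ} {c d : ι → ℝ → ℂ} (hc : SmoothFamily I ν N c)
    (hd : SmoothFamily I ν N d) : SmoothFamily I ν N fun i t => c i t + d i t := by
  induction N generalizing c d with
  | zero => exact ⟨hc.1.add hd.1, fun i => (hc.2 i).add (hd.2 i)⟩
  | succ N ih =>
    obtain ⟨h1, c', h2, h3⟩ := hc
    obtain ⟨h1', d', h2', h3'⟩ := hd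
    exact ⟨h1.add h1', _, fun i t ht => (h2 i t ht).add (h2' i t ht), ih h3 h3'⟩

lemma SmoothFamily.multiplier {N : ℕ} {c : ι → ℝ → ℂ} (hc : SmoothFamily I ν N c) {m : ι → ℂ}
    {D : ℝ} {p : ℕ} (hm : ∀ i, ‖m i‖ ≤ D * (1 + ‖ν i‖) ^ p) :
    SmoothFamily I ν N fun i t => m i * c i t := by
  induction N generalizing c with
  | zero => exact ⟨hc.1.mul fun i _ _ => hm i, fun i => continuousOn_const.mul (hc.2 i)⟩
  | succ N ih =>
    obtain ⟨h1, c', h2, h3⟩ := hc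
    exact ⟨h1.mul fun i _ _ => hm i, _, fun i t ht => (h2 i t ht).const_mul (m i), ih h3⟩

lemma SmoothFamily.const_mul {N : ℕ} {c : ι → ℝ → ℂ} (hc : SmoothFamily I ν N c) (a : ℂ) :
    SmoothFamily I ν N fun i t => a * c i t :=
  hc.multiplier (m := fun _ => a) (D := ‖a‖) (p := 0) (by simp)

lemma SmoothFamily.reindex {N : ℕ} {c : ι → ℝ → ℂ} (hc : SmoothFamily I ν N c) (e : ι ≃ ι)
    {D : ℝ} (he : ∀ i, 1 + ‖ν i‖ ≤ D * (1 + ‖ν (e i)‖)) :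
    SmoothFamily I ν N fun i => c (e i) := by
  induction N generalizing c with
  | zero => exact ⟨hc.1.reindex e he, fun i => hc.2 (e i)⟩
  | succ N ih =>
    obtain ⟨h1, c', h2, h3⟩ := hc
    exact ⟨h1.reindex e he, fun i => c' (e i), fun i t ht => h2 (e i) t ht, ih h3⟩

lemma SmoothFamily.zero (N : ℕ) : SmoothFamily I ν N fun _ _ => 0 := by
  have h0 : RapidDecay I ν fun _ _ => 0 := fun j => ⟨0, summable_zero, by simp⟩
  induction N with
  | zero => exact ⟨h0, fun i => continuousOn_const⟩
  | succ N ih => exact ⟨h0, _, fun i t _ => hasDerivAt_const t 0, ih⟩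

lemma SmoothFamily.sum {N : ℕ} {κ : Type*} (s : Finset κ) {c : κ → ι → ℝ → ℂ}
    (hc : ∀ k ∈ s, SmoothFamily I ν N (c k)) : SmoothFamily I ν N fun i t => ∑ k ∈ s, c k i t := by
  classical
  induction s using Finset.induction_on with
  | empty => simpa using SmoothFamily.zero N
  | insert a s ha ih =>
    simp only [Finset.sum_insert ha]
    exact (hc a (by simp)).add (ih fun k hk => hc k (by simp [hk]))

lemma SmoothFamily.exp_mul {N : ℕ} {c : ι → ℝ → ℂ} (hc : SmoothFamily I ν N c)
    (hI : ∀ t ∈ I, 0 ≤ t) {μ : ℝ} (hμ : 0 ≤ μ) :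
    SmoothFamily I ν N fun i t => (Real.exp (-μ * t) : ℂ) * c i t := by
  have hb : ∀ i : ι, ∀ t ∈ I, ‖(Real.exp (-μ * t) : ℂ)‖ ≤ 1 * (1 + ‖ν i‖) ^ 0 := by
    intro i t ht
    rw [Complex.norm_real, Real.norm_of_nonneg (Real.exp_nonneg _)]
    simpa using mul_nonneg hμ (hI t ht)
  have hd : ∀ t : ℝ, HasDerivAt (fun s : ℝ => (Real.exp (-μ * s) : ℂ))
      ((-μ : ℂ) * (Real.exp (-μ * t) : ℂ)) t := by
    intro t
    have h1 : HasDerivAt (fun s : ℝ => Real.exp (-μ * s)) (Real.exp (-μ * t) * (-μ)) t := by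
      simpa using ((hasDerivAt_id t).const_mul (-μ)).exp
    convert h1.ofReal_comp using 1
    push_cast
    ring
  induction N generalizing c with
  | zero =>
    exact ⟨hc.1.mul hb, fun i => ContinuousOn.mul (by fun_prop) (hc.2 i)⟩
  | succ N ih =>
    have hc0 := hc.of_succ
    obtain ⟨h1, c', h2, h3⟩ := hc
    refine ⟨h1.mul hb, fun i t => (-μ : ℂ) * ((Real.exp (-μ * t) : ℂ) * c i t)
      + (Real.exp (-μ * t) : ℂ) * c' i t, fun i t ht => ?_, ((ih hc0).const_mul _).add (ih h3)⟩
    refine ((hd t).mul (h2 i t ht)).congr_deriv ?_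
    ring

/-- On finitely many modes, exponentially decaying coefficients form a smooth family. -/
lemma SmoothFamily.of_finite [Fintype ι] (hI : ∀ t ∈ I, 0 ≤ t) (b : ι → ℂ) {μ : ι → ℝ}
    (hμ : ∀ i, 0 ≤ μ i) (N : ℕ) :
    SmoothFamily I ν N fun i t => b i * (Real.exp (-μ i * t) : ℂ) := by
  have h1 : RapidDecay I ν fun i t => b i * (Real.exp (-μ i * t) : ℂ) := by
    intro j
    refine ⟨fun i => (1 + ‖ν i‖) ^ j * ‖b i‖, Summable.of_finite, fun i t ht => ?_⟩
    rw [norm_mul, Complex.norm_real, Real.norm_of_nonneg (Real.exp_nonneg _)]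
    refine mul_le_mul_of_nonneg_left ?_ (by positivity)
    refine mul_le_of_le_one_right (norm_nonneg _) (Real.exp_le_one_iff.2 ?_)
    nlinarith [mul_nonneg (hμ i) (hI t ht)]
  induction N with
  | zero => exact ⟨h1, fun i => by fun_prop⟩
  | succ N ih =>
    refine ⟨h1, _, fun i t ht => ?_, ih.multiplier (m := fun i => -μ i)
      (D := ∑ i, |μ i|) (p := 0) fun i => ?_⟩
    · have h2 : HasDerivAt (fun s : ℝ => Real.exp (-μ i * s)) (Real.exp (-μ i * t) * (-μ i)) t := by
        simpa using ((hasDerivAt_id t).const_mul (-μ i)).exp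
      refine (h2.ofReal_comp.const_mul (b i)).congr_deriv ?_
      push_cast
      ring
    · simpa using Finset.single_le_sum (f := fun i => |μ i|) (fun _ _ => abs_nonneg _)
        (Finset.mem_univ i)

/-- The time coordinate, as a complex-valued functional on space-time. -/
noncomputable def timeForm : ℝ × E3 →L[ℝ] ℂ :=
  Complex.ofRealCLM ∘L ContinuousLinearMap.fst ℝ ℝ E3

/-- The `a`-th space coordinate, as a complex-valued functional on space-time. -/
noncomputable def coordForm (a : Fin 3) : ℝ × E3 →L[ℝ] ℂ :=
  Complex.ofRealCLM ∘L (EuclideanSpace.proj a : E3 →L[ℝ] ℝ) ∘L ContinuousLinearMap.snd ℝ ℝ E3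

@[simp] lemma timeForm_apply (z : ℝ × E3) : timeForm z = (z.1 : ℂ) := rfl

@[simp] lemma coordForm_apply (a : Fin 3) (z : ℝ × E3) : coordForm a z = (z.2 a : ℂ) := rfl

lemma inner_eq_sum (ν x : E3) : inner ℝ ν x = ∑ a, ν a * x a := by
  simp [PiLp.inner_apply, mul_comm]

lemma hasFDerivAt_mode {f : ℝ → ℂ} {f' : ℂ} (ν : E3) (z : ℝ × E3) (hf : HasDerivAt f f' z.1) :
    HasFDerivAt (fun z : ℝ × E3 => f z.1 * wave ν z.2)
      ((f' * wave ν z.2) • timeForm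
        + ∑ a, (Complex.I * (ν a : ℂ) * f z.1 * wave ν z.2) • coordForm a) z := by
  have h1 : HasFDerivAt (fun z : ℝ × E3 => f z.1) _ z := hf.hasFDerivAt.comp z hasFDerivAt_fst
  have h2 : HasFDerivAt (fun z : ℝ × E3 => ((inner ℝ ν z.2 : ℝ) : ℂ) * Complex.I)
      (Complex.I • (∑ a, (ν a : ℂ) • coordForm a)) z := by
    have h3 : HasFDerivAt (fun z : ℝ × E3 => Complex.I • (∑ a, (ν a : ℂ) • coordForm a) z)
        (Complex.I • (∑ a, (ν a : ℂ) • coordForm a)) z :=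
      (Complex.I • (∑ a, (ν a : ℂ) • coordForm a)).hasFDerivAt
    refine h3.congr_of_eventuallyEq (.of_forall fun y => ?_)
    simp only [inner_eq_sum, sum_apply, smul_apply,
      coordForm_apply, smul_eq_mul]
    push_cast
    ring
  have h4 := h1.mul h2.cexp
  refine h4.congr_fderiv ?_
  ext y
  · simp [wave]; ring
  · simp only [wave, add_apply, smul_apply,
      ContinuousLinearMap.comp_apply, Fin.sum_univ_three]
    simp
    ring

lemma norm_coord_le (ν : E3) (a : Fin 3) : |ν a| ≤ ‖ν‖ := by
  simpa using PiLp.norm_apply_le ν a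

/-- Smooth families are stable under the multiplier of `∂ₐ`. -/
lemma SmoothFamily.partial {N : ℕ} {c : ι → ℝ → ℂ} (hc : SmoothFamily I ν N c) (a : Fin 3) :
    SmoothFamily I ν N fun i t => Complex.I * (ν i a : ℂ) * c i t :=
  hc.multiplier (D := 1) (p := 1) fun i => by
    simpa using (norm_coord_le (ν i) a).trans (by linarith)

lemma hasFDerivAt_series (hI : IsOpen I) (hI' : IsPreconnected I) {c c' : ι → ℝ → ℂ}
    (hc : RapidDecay I ν c) (hc' : RapidDecay I ν c')
    (hd : ∀ i, ∀ t ∈ I, HasDerivAt (c i) (c' i t) t) {z : ℝ × E3} (hz : z.1 ∈ I) :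
    HasFDerivAt (fun z : ℝ × E3 => series ν (fun i => c i z.1) z.2)
      (series ν (fun i => c' i z.1) z.2 • timeForm
        + ∑ a, series ν (fun i => Complex.I * (ν i a : ℂ) * c i z.1) z.2 • coordForm a) z := by
  have hp : ∀ a, RapidDecay I ν fun i t => Complex.I * (ν i a : ℂ) * c i t := fun a =>
    hc.mul (D := 1) (p := 1) fun i _ _ => by
      simpa using (norm_coord_le (ν i) a).trans (by linarith)
  obtain ⟨C', hC', hb'⟩ := hc'.exists_summable
  choose C hC hb using fun a => (hp a).exists_summable
  have hmain := hasFDerivAt_tsum_of_isPreconnected (𝕜 := ℝ)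
    (f := fun i (z : ℝ × E3) => c i z.1 * wave (ν i) z.2)
    (f' := fun i (z : ℝ × E3) => (c' i z.1 * wave (ν i) z.2) • timeForm
        + ∑ a, (Complex.I * (ν i a : ℂ) * c i z.1 * wave (ν i) z.2) • coordForm a)
    (u := fun i => C' i * ‖timeForm‖ + ∑ a, C a i * ‖coordForm a‖) (s := I ×ˢ Set.univ)
    ((hC'.mul_right _).add (summable_sum fun a _ => (hC a).mul_right _))
    (hI.prod isOpen_univ) (hI'.prod isPreconnected_univ)
    (fun i z hz => hasFDerivAt_mode (ν i) z (hd i z.1 hz.1))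
    (fun i z hz => by
      refine (norm_add_le _ _).trans (add_le_add ?_ ((norm_sum_le _ _).trans
        (Finset.sum_le_sum fun a _ => ?_)))
      · rw [norm_smul, norm_mul, norm_wave, mul_one]
        gcongr
        exact hb' i z.1 hz.1
      · rw [norm_smul, norm_mul _ (wave _ _), norm_wave, mul_one]
        gcongr
        exact hb a i z.1 hz.1)
    (x₀ := z) (x := z) ⟨hz, trivial⟩ (summable_series ν (hc.summable_norm hz) z.2) ⟨hz, trivial⟩
  refine hmain.congr_fderiv (HasSum.tsum_eq ?_)
  exact ((summable_series ν (hc'.summable_norm hz) z.2).hasSum.smul_const timeForm).add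
    (hasSum_sum fun a _ =>
      (summable_series ν ((hp a).summable_norm hz) z.2).hasSum.smul_const (coordForm a))

lemma contDiffOn_series (hI : IsOpen I) (hI' : IsPreconnected I) {N : ℕ} {c : ι → ℝ → ℂ}
    (hc : SmoothFamily I ν N c) :
    ContDiffOn ℝ N (fun z : ℝ × E3 => series ν (fun i => c i z.1) z.2) (I ×ˢ Set.univ) := by
  induction N generalizing c with
  | zero =>
    obtain ⟨C, hC, hb⟩ := hc.1.exists_summable
    rw [Nat.cast_zero, contDiffOn_zero]
    refine continuousOn_tsum (fun i => ?_) hC fun i z hz => by simpa using hb i z.1 hz.1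
    exact ((hc.2 i).comp continuousOn_fst fun z hz => hz.1).mul (by fun_prop)
  | succ N ih =>
    have hc0 := hc.of_succ
    obtain ⟨h1, c', h2, h3⟩ := hc
    have hopen : IsOpen (I ×ˢ (Set.univ : Set E3)) := hI.prod isOpen_univ
    have hder := fun z (hz : z ∈ I ×ˢ (Set.univ : Set E3)) =>
      hasFDerivAt_series hI hI' h1 h3.rapidDecay h2 hz.1
    push_cast
    rw [contDiffOn_succ_iff_fderiv_of_isOpen hopen]
    refine ⟨fun z hz => (hder z hz).differentiableAt.differentiableWithinAt, by simp, ?_⟩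
    refine ContDiffOn.congr ?_ fun z hz => (hder z hz).fderiv
    exact ((ih h3).smul contDiffOn_const).add
      (ContDiffOn.sum fun a _ => (ih (hc0.partial a)).smul contDiffOn_const)

end Smooth

section Smooth

variable {ι : Type*} {I : Set ℝ} {ν : ι → E3}

lemma contDiff_series_re_slice (hI : IsOpen I) (hI' : IsPreconnected I) {N : ℕ} {c : ι → ℝ → ℂ}
    (hc : SmoothFamily I ν N c) {t : ℝ} (ht : t ∈ I) :
    ContDiff ℝ N fun y => (series ν (fun i => c i t) y).re := by
  have h1 : ContDiff ℝ N fun y : E3 => (t, y) := by fun_prop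
  have h2 := (contDiffOn_series hI hI' hc).comp (contDiffOn_univ.2 h1) fun y _ => ⟨ht, trivial⟩
  exact Complex.reCLM.contDiff.comp (contDiffOn_univ.1 h2)

lemma hasDerivAt_series_re (hI : IsOpen I) (hI' : IsPreconnected I) {c c' : ι → ℝ → ℂ}
    (hc : RapidDecay I ν c) (hc' : RapidDecay I ν c')
    (hd : ∀ i, ∀ t ∈ I, HasDerivAt (c i) (c' i t) t) {t : ℝ} (ht : t ∈ I) (x : E3) :
    HasDerivAt (fun τ => (series ν (fun i => c i τ) x).re) (series ν (fun i => c' i t) x).re t := by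
  have h1 : HasDerivAt (fun τ : ℝ => (τ, x)) ((1 : ℝ), (0 : E3)) t :=
    (hasDerivAt_id t).prodMk (hasDerivAt_const t x)
  have h2 := (hasFDerivAt_series hI hI' hc hc' hd (z := (t, x)) ht).comp_hasDerivAt t h1
  have h3 := Complex.reCLM.hasFDerivAt.comp_hasDerivAt t h2
  simpa [Function.comp_def] using h3

lemma fderiv_series_re (hI : IsOpen I) (hI' : IsPreconnected I) {N : ℕ} {c : ι → ℝ → ℂ}
    (hc : SmoothFamily I ν (N + 1) c) {t : ℝ} (ht : t ∈ I) (x : E3) (a : Fin 3) :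
    fderiv ℝ (fun y => (series ν (fun i => c i t) y).re) x (unitVec a)
      = (series ν (fun i => Complex.I * (ν i a : ℂ) * c i t) x).re := by
  obtain ⟨h1, c', h2, h3⟩ := hc
  have h4 : HasFDerivAt (fun y : E3 => (t, y)) (ContinuousLinearMap.inr ℝ ℝ E3) x :=
    hasFDerivAt_prodMk_right t x
  have h5 := (hasFDerivAt_series hI hI' h1 h3.rapidDecay h2 (z := (t, x)) ht).comp x h4
  have h6 := Complex.reCLM.hasFDerivAt.comp x h5
  have h7 := h6.fderiv
  simp only [Function.comp_def, Complex.reCLM_apply] at h7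
  rw [h7]
  fin_cases a <;> simp [unitVec, Fin.sum_univ_three]

/-- The Laplacian acts on Fourier series with the multiplier `-‖νᵢ‖²`. -/
lemma laplacian_series_re (hI : IsOpen I) (hI' : IsPreconnected I) {c : ι → ℝ → ℂ}
    (hc : SmoothFamily I ν 2 c) {t : ℝ} (ht : t ∈ I) (x : E3) :
    Laplacian.laplacian (fun y => (series ν (fun i => c i t) y).re) x
      = (series ν (fun i => -(‖ν i‖ ^ 2 : ℝ) * c i t) x).re := by
  have hsm := contDiff_series_re_slice hI hI' hc ht
  rw [InnerProductSpace.laplacian_eq_iteratedFDeriv_orthonormalBasis _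
    (EuclideanSpace.basisFun (Fin 3) ℝ)]
  have hdiff : DifferentiableAt ℝ
      (fderiv ℝ fun y => (series ν (fun i => c i t) y).re) x :=
    ((hsm.fderiv_right (m := 1) (by norm_num)).differentiable (by simp)).differentiableAt
  have key : ∀ a : Fin 3, iteratedFDeriv ℝ 2 (fun y => (series ν (fun i => c i t) y).re) x
      ![EuclideanSpace.basisFun (Fin 3) ℝ a, EuclideanSpace.basisFun (Fin 3) ℝ a]
      = (series ν (fun i => Complex.I * (ν i a : ℂ) * (Complex.I * (ν i a : ℂ) * c i t)) x).re := by
    intro a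
    rw [iteratedFDeriv_two_apply]
    have hb : EuclideanSpace.basisFun (Fin 3) ℝ a = unitVec a := by simp [unitVec]
    simp only [Matrix.cons_val_zero, Matrix.cons_val_one, hb]
    have h1 : fderiv ℝ (fun y => fderiv ℝ (fun y => (series ν (fun i => c i t) y).re) y
        (unitVec a)) x (unitVec a)
        = fderiv ℝ (fderiv ℝ (fun y => (series ν (fun i => c i t) y).re)) x
          (unitVec a) (unitVec a) := by
      rw [fderiv_clm_apply hdiff (differentiableAt_const _)]
      simp
    rw [← h1]
    simp only [fderiv_series_re hI hI' hc ht]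
    exact fderiv_series_re hI hI' (hc.of_succ.partial a) ht x a
  simp only [key]
  have hs : ∀ a, Summable fun i => Complex.I * (ν i a : ℂ) * (Complex.I * (ν i a : ℂ) * c i t)
      * wave (ν i) x := fun a =>
    summable_series ν (((hc.partial a).partial a).rapidDecay.summable_norm ht) x
  rw [← Complex.re_sum]
  simp only [series]
  rw [← Summable.tsum_finsetSum fun a _ => hs a]
  congr 2
  ext i
  rw [EuclideanSpace.norm_sq_eq]
  simp only [Fin.sum_univ_three, Real.norm_eq_abs, sq_abs]
  push_cast
  linear_combination ((ν i 0 : ℂ) ^ 2 + (ν i 1 : ℂ) ^ 2 + (ν i 2 : ℂ) ^ 2) * c i t * wave (ν i) x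
    * Complex.I_sq

/-- Series with integer frequencies are `2π`-periodic. -/
lemma spacePeriodic_series_re (hν : ∀ i a, ∃ m : ℤ, ν i a = m) (c : ι → ℂ) :
    SpacePeriodic fun x => (series ν c x).re := by
  intro a x
  simp only [series]
  congr 2
  ext i
  obtain ⟨m, hm⟩ := hν i a
  have : wave (ν i) ((2 * Real.pi) • unitVec a) = 1 := by
    rw [wave, Complex.exp_eq_one_iff]
    refine ⟨m, ?_⟩
    rw [inner_smul_right, unitVec, EuclideanSpace.inner_single_right, hm]
    simp
    ring
  rw [wave_add_right, this, mul_one]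

end Smooth

/-! ### Reduction of the Boussinesq system to a linear scalar equation -/

lemma contDiff_slice {F : Type*} [NormedAddCommGroup F] [NormedSpace ℝ F] {f : ℝ → E3 → F}
    {J : Set ℝ} (h : ContDiffOn ℝ ∞ (fun z : ℝ × E3 => f z.1 z.2) (J ×ˢ Set.univ)) {t : ℝ}
    (ht : t ∈ J) : ContDiff ℝ ∞ (f t) := by
  have h1 : ContDiff ℝ ∞ fun y : E3 => (t, y) := by fun_prop
  exact contDiffOn_univ.1 (h.comp (contDiffOn_univ.2 h1) fun y _ => ⟨ht, trivial⟩)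

lemma unitVec_apply (i j : Fin 3) : unitVec i j = if j = i then 1 else 0 := by
  simp [unitVec]

/-- A shear flow `w e₂` solving the heat equation and a density `ρ` that it advects, both
independent of `x₃`, give an exact solution of the Boussinesq system: the vertical velocity driven
by the buoyancy is `t ρ`, because `(∂ₜ - Δ + w ∂₂) (t ρ) = ρ`, and no pressure is needed. -/
theorem isSmoothPeriodicSolution_of_shear {T : ℝ} (hT : 0 < T) {w ρ : ℝ → E3 → ℝ}
    (hw : ContDiffOn ℝ ∞ (fun z : ℝ × E3 => w z.1 z.2) (Set.Icc 0 T ×ˢ Set.univ))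
    (hρ : ContDiffOn ℝ ∞ (fun z : ℝ × E3 => ρ z.1 z.2) (Set.Icc 0 T ×ˢ Set.univ))
    (pw : ∀ t ∈ Set.Icc 0 T, SpacePeriodic (w t)) (pρ : ∀ t ∈ Set.Icc 0 T, SpacePeriodic (ρ t))
    (ew : ∀ t ∈ Set.Icc 0 T, ∀ x, HasDerivAt (fun τ => w τ x) (Laplacian.laplacian (w t) x) t)
    (eρ : ∀ t ∈ Set.Icc 0 T, ∀ x, HasDerivAt (fun τ => ρ τ x)
      (Laplacian.laplacian (ρ t) x - w t x * fderiv ℝ (ρ t) x (unitVec 1)) t)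
    (w1 : ∀ t ∈ Set.Icc 0 T, ∀ x, fderiv ℝ (w t) x (unitVec 1) = 0)
    (w2 : ∀ t ∈ Set.Icc 0 T, ∀ x, fderiv ℝ (w t) x (unitVec 2) = 0)
    (ρ2 : ∀ t ∈ Set.Icc 0 T, ∀ x, fderiv ℝ (ρ t) x (unitVec 2) = 0) :
    IsSmoothPeriodicSolution T
      (fun t x => w t x • unitVec 1 + (t * ρ t x) • unitVec 2) ρ (fun _ _ => 0) := by
  have cw : ∀ t ∈ Set.Icc 0 T, ContDiff ℝ ∞ (w t) := fun t ht => contDiff_slice hw ht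
  have cρ : ∀ t ∈ Set.Icc 0 T, ContDiff ℝ ∞ (ρ t) := fun t ht => contDiff_slice hρ ht
  have fu : ∀ t ∈ Set.Icc 0 T, ∀ x,
      HasFDerivAt (fun x => w t x • unitVec 1 + (t * ρ t x) • unitVec 2)
        ((fderiv ℝ (w t) x).smulRight (unitVec 1)
          + (t • fderiv ℝ (ρ t) x).smulRight (unitVec 2)) x := by
    intro t ht x
    have h1 := (((cw t ht).differentiable (by simp)) x).hasFDerivAt.smul_const (unitVec 1)
    have h2 := ((((cρ t ht).differentiable (by simp)) x).hasFDerivAt.const_mul t).smul_const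
      (unitVec 2)
    exact h1.add h2
  have uniq : ∀ t ∈ Set.Icc 0 T, UniqueDiffWithinAt ℝ (Set.Icc 0 T) t := uniqueDiffOn_Icc hT
  refine ⟨?_, hρ, contDiffOn_const, ?_, pρ, fun t ht i x => rfl, ?_, ?_, ?_⟩
  · exact (hw.smul contDiffOn_const).add ((contDiffOn_fst.mul hρ).smul contDiffOn_const)
  · intro t ht i x
    simp only [pw t ht i x, pρ t ht i x]
  · intro t ht x
    have hd : HasDerivAt (fun τ => w τ x • unitVec 1 + (τ * ρ τ x) • unitVec 2)
        (Laplacian.laplacian (w t) x • unitVec 1 + (1 * ρ t x + t *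
          (Laplacian.laplacian (ρ t) x - w t x * fderiv ℝ (ρ t) x (unitVec 1))) • unitVec 2) t :=
      ((ew t ht x).smul_const _).add (((hasDerivAt_id t).mul (eρ t ht x)).smul_const _)
    have hL : Laplacian.laplacian (fun x => w t x • unitVec 1 + (t * ρ t x) • unitVec 2) x
        = Laplacian.laplacian (w t) x • unitVec 1
          + (t * Laplacian.laplacian (ρ t) x) • unitVec 2 := by
      have h2w : ContDiffAt ℝ 2 (w t) x :=
        (contDiff_infty.1 (cw t ht) 2).contDiffAt
      have h2ρ : ContDiffAt ℝ 2 (ρ t) x :=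
        (contDiff_infty.1 (cρ t ht) 2).contDiffAt
      have e1 := h2w.laplacian_CLM_comp_left
        (l := ContinuousLinearMap.toSpanSingleton ℝ (unitVec 1))
      have e2 := h2ρ.laplacian_CLM_comp_left
        (l := t • ContinuousLinearMap.toSpanSingleton ℝ (unitVec 2))
      have e3 := ContDiffAt.laplacian_add
        (h2w.continuousLinearMap_comp (ContinuousLinearMap.toSpanSingleton ℝ (unitVec 1)))
        (h2ρ.continuousLinearMap_comp (t • ContinuousLinearMap.toSpanSingleton ℝ (unitVec 2)))
      rw [e1, e2] at e3
      have e4 : (fun x => w t x • unitVec 1 + (t * ρ t x) • unitVec 2)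
          = ((⇑(ContinuousLinearMap.toSpanSingleton ℝ (unitVec 1)) ∘ w t)
            + (⇑(t • ContinuousLinearMap.toSpanSingleton ℝ (unitVec 2)) ∘ ρ t)) := by
        ext1 y
        simp [mul_smul]
      rw [e4, e3]
      simp [mul_smul]
    rw [hd.hasDerivWithinAt.derivWithin (uniq t ht), hL, (fu t ht x).fderiv, gradient_fun_const]
    simp only [add_apply, ContinuousLinearMap.smulRight_apply, map_add, map_smul, smul_apply,
      w1 t ht x, w2 t ht x, ρ2 t ht x, smul_eq_mul]
    module
  · intro t ht x
    rw [(eρ t ht x).hasDerivWithinAt.derivWithin (uniq t ht)]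
    simp only [map_add, map_smul, ρ2 t ht x, smul_eq_mul]
    ring
  · intro t ht x
    rw [divergence]
    simp only [(fu t ht x).fderiv]
    simp [Fin.sum_univ_three, unitVec_apply, w1 t ht x, ρ2 t ht x]

/-! ### The perturbation series for the advected density -/

section Dyson

/-- Half the amplitude at time `t` of the mode `cos (kⱼ x₁)` of the shear flow. -/
noncomputable def amp (κ : ℝ) (k : ℕ → ℕ) (j : ℕ) (t : ℝ) : ℝ :=
  κ * k j / 2 * Real.exp (-(k j : ℝ) ^ 2 * t)

/-- Multiplication by the shear flow `∑ⱼ κ kⱼ exp (-kⱼ² t) cos (kⱼ x₁)`, on the side of Fourier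
coefficients. -/
noncomputable def shearMul (κ : ℝ) (k : ℕ → ℕ) (r : ℕ) (f : ℤ → ℝ → ℂ) (n : ℤ) (t : ℝ) : ℂ :=
  ∑ j ∈ Finset.range r, (amp κ k j t : ℂ) * (f (n - k j) t + f (n + k j) t)

/-- The eigenvalue of `-Δ` on `exp (i (n x₁ + x₂))`. -/
noncomputable def rate (n : ℤ) : ℝ := (n : ℝ) ^ 2 + 1

/-- The Fourier coefficients of `∑ⱼ κ kⱼ cos (kⱼ x₁)`. -/
noncomputable def initCoeff (κ : ℝ) (k : ℕ → ℕ) (r : ℕ) (n : ℤ) : ℝ :=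
  ∑ j ∈ Finset.range r, if n.natAbs = k j then κ * k j / 2 else 0

/-- The terms of the Dyson series: the free heat flow, and then repeatedly the Duhamel integral of
the advection term of the preceding one. -/
noncomputable def dyson (κ : ℝ) (k : ℕ → ℕ) (r : ℕ) : ℕ → ℤ → ℝ → ℂ
  | 0, n, t => (Real.exp (-rate n * t) : ℂ) * (initCoeff κ k r n : ℂ)
  | m + 1, n, t => -Complex.I * (Real.exp (-rate n * t) : ℂ) *
      ∫ s in (0 : ℝ)..t, (Real.exp (rate n * s) : ℂ) * shearMul κ k r (dyson κ k r m) n s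

/-- The Fourier coefficients in `x₁` of the density, up to the factor `exp (i x₂)`. -/
noncomputable def density (κ : ℝ) (k : ℕ → ℕ) (r : ℕ) (n : ℤ) (t : ℝ) : ℂ :=
  ∑' m, dyson κ k r m n t

variable {κ : ℝ} {k : ℕ → ℕ} {r : ℕ}

lemma rate_pos (n : ℤ) : 0 < rate n := by unfold rate; positivity

lemma amp_nonneg (hκ : 0 ≤ κ) (j : ℕ) (t : ℝ) : 0 ≤ amp κ k j t := by unfold amp; positivity

@[fun_prop] lemma continuous_amp (j : ℕ) : Continuous (amp κ k j) := by
  unfold amp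
  fun_prop

lemma continuous_shearMul {f : ℤ → ℝ → ℂ} (hf : ∀ n, Continuous (f n)) (n : ℤ) :
    Continuous (shearMul κ k r f n) := by
  unfold shearMul
  have := hf
  fun_prop

lemma continuous_dyson (m : ℕ) (n : ℤ) : Continuous (dyson κ k r m n) := by
  induction m generalizing n with
  | zero => simp only [dyson]; fun_prop
  | succ m ih =>
    have h1 := continuous_shearMul (κ := κ) (k := k) (r := r) ih n
    have h2 : Continuous fun t => ∫ s in (0 : ℝ)..t,
        (Real.exp (rate n * s) : ℂ) * shearMul κ k r (dyson κ k r m) n s :=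
      intervalIntegral.continuous_primitive
        (fun a b => (Continuous.intervalIntegrable (by fun_prop) a b)) 0
    simp only [dyson]
    fun_prop

lemma hasDerivAt_exp_mul (a t : ℝ) :
    HasDerivAt (fun s : ℝ => (Real.exp (a * s) : ℂ)) (a * (Real.exp (a * t) : ℂ)) t := by
  have h2 : HasDerivAt (fun s : ℝ => Real.exp (a * s)) (Real.exp (a * t) * a) t := by
    simpa using ((hasDerivAt_id t).const_mul a).exp
  refine h2.ofReal_comp.congr_deriv ?_
  push_cast
  ring

lemma hasDerivAt_dyson_zero (n : ℤ) (t : ℝ) :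
    HasDerivAt (dyson κ k r 0 n) (-rate n * dyson κ k r 0 n t) t := by
  have h := (hasDerivAt_exp_mul (-rate n) t).mul_const (initCoeff κ k r n : ℂ)
  refine h.congr_deriv ?_
  simp only [dyson]
  push_cast
  ring

lemma hasDerivAt_dyson_succ (m : ℕ) (n : ℤ) (t : ℝ) :
    HasDerivAt (dyson κ k r (m + 1) n) (-rate n * dyson κ k r (m + 1) n t
      - Complex.I * shearMul κ k r (dyson κ k r m) n t) t := by
  have hc : Continuous (shearMul κ k r (dyson κ k r m) n) :=
    continuous_shearMul (continuous_dyson m) n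
  have hc' : Continuous fun s =>
      (Real.exp (rate n * s) : ℂ) * shearMul κ k r (dyson κ k r m) n s := by fun_prop
  have h1 := intervalIntegral.integral_hasDerivAt_right (hc'.intervalIntegrable 0 t)
    (hc'.stronglyMeasurableAtFilter _ _) hc'.continuousAt
  have h2 := ((hasDerivAt_exp_mul (-rate n) t).const_mul (-Complex.I)).mul h1
  refine h2.congr_deriv ?_
  have he : (Real.exp (-rate n * t) : ℂ) * (Real.exp (rate n * t) : ℂ) = 1 := by
    rw [← Complex.ofReal_mul, ← Real.exp_add]
    simp
  simp only [dyson]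
  push_cast at he ⊢
  linear_combination (-Complex.I * shearMul κ k r (dyson κ k r m) n t) * he

/-- The heat semigroup does not increase coefficients, so a Duhamel term is bounded by the integral
of the source. -/
lemma norm_dyson_succ_le {m : ℕ} {n : ℤ} {t : ℝ} (ht : 0 ≤ t) {φ : ℝ → ℝ} (hφ : Continuous φ)
    (hb : ∀ s ∈ Set.Icc 0 t, ‖shearMul κ k r (dyson κ k r m) n s‖ ≤ φ s) :
    ‖dyson κ k r (m + 1) n t‖ ≤ ∫ s in (0 : ℝ)..t, φ s := by
  have he : dyson κ k r (m + 1) n t = -Complex.I * ∫ s in (0 : ℝ)..t,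
      (Real.exp (-rate n * (t - s)) : ℂ) * shearMul κ k r (dyson κ k r m) n s := by
    rw [dyson, mul_assoc, ← intervalIntegral.integral_const_mul]
    congr 2
    ext s
    rw [← mul_assoc, ← Complex.ofReal_mul, ← Real.exp_add]
    congr 3
    ring_nf
  rw [he, norm_mul, norm_neg, Complex.norm_I, one_mul]
  refine intervalIntegral.norm_integral_le_of_norm_le ht (.of_forall fun s hs => ?_)
    (hφ.intervalIntegrable 0 t)
  rw [norm_mul, Complex.norm_real, Real.norm_of_nonneg (Real.exp_nonneg _)]
  have h1 : Real.exp (-rate n * (t - s)) ≤ 1 := by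
    rw [Real.exp_le_one_iff]
    nlinarith [rate_pos n, hs.2]
  calc _ ≤ 1 * ‖shearMul κ k r (dyson κ k r m) n s‖ := by gcongr
    _ ≤ φ s := by rw [one_mul]; exact hb s ⟨hs.1.le, hs.2⟩

lemma norm_shearMul_le (hκ : 0 ≤ κ) (f : ℤ → ℝ → ℂ) (n : ℤ) (t : ℝ) :
    ‖shearMul κ k r f n t‖ ≤
      ∑ j ∈ Finset.range r, amp κ k j t * (‖f (n - k j) t‖ + ‖f (n + k j) t‖) := by
  refine (norm_sum_le _ _).trans (Finset.sum_le_sum fun j _ => ?_)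
  rw [norm_mul, Complex.norm_real, Real.norm_of_nonneg (amp_nonneg hκ j t)]
  gcongr
  · exact amp_nonneg hκ j t
  · exact norm_add_le _ _

/-- The size of the initial data in the space with weight `exp |n|`. -/
noncomputable def initSize (κ : ℝ) (k : ℕ → ℕ) (r : ℕ) : ℝ :=
  ∑ j ∈ Finset.range r, κ * k j / 2 * Real.exp (k j)

/-- A bound for the norm of `shearMul` on the space with weight `exp |n|`. -/
noncomputable def shearSize (κ : ℝ) (k : ℕ → ℕ) (r : ℕ) : ℝ :=
  ∑ j ∈ Finset.range r, κ * k j * Real.exp (k j)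

lemma initSize_nonneg (hκ : 0 ≤ κ) : 0 ≤ initSize κ k r :=
  Finset.sum_nonneg fun _ _ => by positivity

lemma shearSize_nonneg (hκ : 0 ≤ κ) : 0 ≤ shearSize κ k r :=
  Finset.sum_nonneg fun _ _ => by positivity

lemma amp_le (hκ : 0 ≤ κ) (j : ℕ) {t : ℝ} (ht : 0 ≤ t) : amp κ k j t ≤ κ * k j / 2 := by
  unfold amp
  refine mul_le_of_le_one_right (by positivity) (Real.exp_le_one_iff.2 ?_)
  nlinarith [sq_nonneg (k j : ℝ)]

lemma norm_shearMul_le_of_weight (hκ : 0 ≤ κ) {f : ℤ → ℝ → ℂ} {t X : ℝ} (ht : 0 ≤ t) (hX : 0 ≤ X)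
    (hf : ∀ n, ‖f n t‖ ≤ X * Real.exp (-|(n : ℝ)|)) (n : ℤ) :
    ‖shearMul κ k r f n t‖ ≤ shearSize κ k r * X * Real.exp (-|(n : ℝ)|) := by
  refine (norm_shearMul_le hκ f n t).trans ?_
  rw [shearSize, Finset.sum_mul, Finset.sum_mul]
  refine Finset.sum_le_sum fun j _ => ?_
  have key : ∀ p : ℤ, |(n : ℝ)| ≤ |(p : ℝ)| + k j →
      ‖f p t‖ ≤ X * (Real.exp (k j) * Real.exp (-|(n : ℝ)|)) := by
    intro p hp
    refine (hf p).trans ?_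
    rw [← Real.exp_add]
    gcongr
    linarith
  have hk : |(k j : ℝ)| = k j := abs_of_nonneg (by positivity)
  have h1 := key (n - k j) (by
    push_cast
    have := abs_add_le ((n : ℝ) - k j) (k j)
    rwa [sub_add_cancel, hk] at this)
  have h2 := key (n + k j) (by
    push_cast
    have := abs_sub (a := (n : ℝ) + k j) (b := k j)
    rwa [add_sub_cancel_right, hk] at this)
  have := amp_le (k := k) hκ j ht
  calc _ ≤ κ * k j / 2 * (X * (Real.exp (k j) * Real.exp (-|(n : ℝ)|))
        + X * (Real.exp (k j) * Real.exp (-|(n : ℝ)|))) := by gcongr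
    _ = _ := by ring

lemma abs_initCoeff_le (hκ : 0 ≤ κ) (n : ℤ) :
    |initCoeff κ k r n| ≤ initSize κ k r * Real.exp (-|(n : ℝ)|) := by
  rw [initCoeff, abs_of_nonneg (Finset.sum_nonneg fun _ _ => by split_ifs <;> positivity),
    initSize, Finset.sum_mul]
  refine Finset.sum_le_sum fun j _ => ?_
  split_ifs with h
  · have : |(n : ℝ)| = k j := by rw [← h, Nat.cast_natAbs, Int.cast_abs]
    rw [this, mul_assoc, ← Real.exp_add]
    simp
  · positivity

lemma integral_pow_div_factorial (B t : ℝ) (m : ℕ) :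
    ∫ s in (0 : ℝ)..t, B * ((B * s) ^ m / m.factorial) = (B * t) ^ (m + 1) / (m + 1).factorial := by
  simp only [mul_pow, mul_div_assoc, intervalIntegral.integral_const_mul,
    intervalIntegral.integral_div, integral_pow, Nat.factorial_succ]
  push_cast
  have : (m.factorial : ℝ) ≠ 0 := by positivity
  field_simp
  simp only [ne_eq, Nat.add_eq_zero_iff, one_ne_zero, and_false, not_false_eq_true, zero_pow,
    sub_zero]
  ring

/-- Factorial decay of the Dyson series: the coupling is bounded on sequences with weight
`exp |n|`. -/
lemma norm_dyson_le (hκ : 0 ≤ κ) (m : ℕ) (n : ℤ) {t : ℝ} (ht : 0 ≤ t) :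
    ‖dyson κ k r m n t‖ ≤
      initSize κ k r * ((shearSize κ k r * t) ^ m / m.factorial) * Real.exp (-|(n : ℝ)|) := by
  induction m generalizing n t with
  | zero =>
    simp only [dyson, pow_zero, Nat.factorial_zero, Nat.cast_one, div_one, mul_one]
    rw [norm_mul, Complex.norm_real, Complex.norm_real, Real.norm_of_nonneg (Real.exp_nonneg _)]
    refine le_trans (mul_le_of_le_one_left (norm_nonneg _) (Real.exp_le_one_iff.2 ?_))
      (abs_initCoeff_le hκ n)
    nlinarith [rate_pos n]
  | succ m ih =>
    set B := shearSize κ k r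
    have hB : 0 ≤ B := shearSize_nonneg hκ
    have hA : 0 ≤ initSize κ k r := initSize_nonneg hκ
    refine (norm_dyson_succ_le ht (φ := fun s =>
      (initSize κ k r * Real.exp (-|(n : ℝ)|)) * (B * ((B * s) ^ m / m.factorial)))
      (by fun_prop) fun s hs => ?_).trans ?_
    · have hs0 : 0 ≤ s := hs.1
      refine (norm_shearMul_le_of_weight hκ hs0 (by positivity) (fun p => ih p hs0) n).trans_eq ?_
      ring
    · rw [intervalIntegral.integral_const_mul, integral_pow_div_factorial]
      exact le_of_eq (by ring)

lemma summable_dyson_majorant (x : ℝ) (A E : ℝ) :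
    Summable fun m : ℕ => A * (x ^ m / m.factorial) * E :=
  ((Real.summable_pow_div_factorial x).mul_left A).mul_right E

lemma summable_norm_dyson (hκ : 0 ≤ κ) (n : ℤ) {t : ℝ} (ht : 0 ≤ t) :
    Summable fun m => ‖dyson κ k r m n t‖ :=
  (summable_dyson_majorant _ _ _).of_nonneg_of_le (fun _ => norm_nonneg _)
    fun m => norm_dyson_le hκ m n ht

lemma norm_density_le (hκ : 0 ≤ κ) (n : ℤ) {t : ℝ} (ht : 0 ≤ t) :
    ‖density κ k r n t‖ ≤
      initSize κ k r * Real.exp (shearSize κ k r * t) * Real.exp (-|(n : ℝ)|) := by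
  refine (norm_tsum_le_tsum_norm (summable_norm_dyson hκ n ht)).trans ?_
  refine ((summable_norm_dyson hκ n ht).tsum_le_tsum (fun m => norm_dyson_le hκ m n ht)
    (summable_dyson_majorant _ _ _)).trans_eq ?_
  rw [tsum_mul_right, tsum_mul_left, Real.exp_eq_exp_ℝ, NormedSpace.exp_eq_tsum_div]

/-- At small times the density is close to the free heat flow of its initial data. -/
lemma norm_density_sub_le (hκ : 0 ≤ κ) (n : ℤ) {t : ℝ} (ht : 0 ≤ t) :
    ‖density κ k r n t - dyson κ k r 0 n t‖ ≤
      initSize κ k r * (Real.exp (shearSize κ k r * t) - 1) * Real.exp (-|(n : ℝ)|) := by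
  have hs := summable_norm_dyson (k := k) (r := r) hκ n ht
  rw [density, hs.of_norm.tsum_eq_zero_add, add_sub_cancel_left]
  have hs1 := (summable_nat_add_iff 1).2 hs
  have hm := summable_dyson_majorant (shearSize κ k r * t) (initSize κ k r) (Real.exp (-|(n : ℝ)|))
  refine (norm_tsum_le_tsum_norm hs1).trans ?_
  refine (hs1.tsum_le_tsum (fun m => norm_dyson_le hκ (m + 1) n ht)
    ((summable_nat_add_iff 1).2 hm)).trans_eq ?_
  have h2 := hm.tsum_eq_zero_add
  rw [tsum_mul_right, tsum_mul_left, ← congrFun NormedSpace.exp_eq_tsum_div,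
    ← Real.exp_eq_exp_ℝ] at h2
  simp only [pow_zero, Nat.factorial_zero, Nat.cast_one, div_one, mul_one] at h2
  linarith

lemma shearMul_density (hκ : 0 ≤ κ) (n : ℤ) {t : ℝ} (ht : 0 ≤ t) :
    shearMul κ k r (density κ k r) n t = ∑' m, shearMul κ k r (dyson κ k r m) n t := by
  have hs := fun n => (summable_norm_dyson (k := k) (r := r) hκ n ht).of_norm
  simp only [shearMul]
  rw [Summable.tsum_finsetSum fun j _ => ((hs _).add (hs _)).mul_left _]
  refine Finset.sum_congr rfl fun j _ => ?_
  rw [tsum_mul_left, (hs _).tsum_add (hs _), density, density]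

lemma hasDerivAt_density (hκ : 0 ≤ κ) (n : ℤ) {t : ℝ} (ht : 0 < t) :
    HasDerivAt (density κ k r n) (-rate n * density κ k r n t
      - Complex.I * shearMul κ k r (density κ k r) n t) t := by
  set B := shearSize κ k r
  set A := initSize κ k r
  have hB : 0 ≤ B := shearSize_nonneg hκ
  have hA : 0 ≤ A := initSize_nonneg hκ
  have ht1 : t ∈ Set.Ioo 0 (t + 1) := ⟨ht, by linarith⟩
  let d : ℕ → ℝ → ℂ := fun m s => match m with
    | 0 => 0
    | m + 1 => shearMul κ k r (dyson κ k r m) n s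
  have hd : ∀ m s, HasDerivAt (dyson κ k r m n) (-rate n * dyson κ k r m n s - Complex.I * d m s)
      s := by
    rintro (_ | m) s
    · simpa [d] using hasDerivAt_dyson_zero n s
    · exact hasDerivAt_dyson_succ m n s
  let D : ℕ → ℝ := fun m => match m with
    | 0 => 0
    | m + 1 => B * (A * ((B * (t + 1)) ^ m / m.factorial)) * Real.exp (-|(n : ℝ)|)
  have hDs : Summable D := by
    rw [← summable_nat_add_iff 1]
    exact (((summable_dyson_majorant (B * (t + 1)) A 1).mul_left B).mul_right
      (Real.exp (-|(n : ℝ)|))).congr fun m => by simp [D]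
  have hmono : ∀ m : ℕ, ∀ s ∈ Set.Ioo 0 (t + 1),
      A * ((B * s) ^ m / m.factorial) ≤ A * ((B * (t + 1)) ^ m / m.factorial) := by
    intro m s hs
    have h1 := hs.1.le
    have h2 := hs.2.le
    gcongr
  have hdD : ∀ m, ∀ s ∈ Set.Ioo 0 (t + 1), ‖d m s‖ ≤ D m := by
    rintro (_ | m) s hs
    · simp [d, D]
    · have h1 := hs.1.le
      refine (norm_shearMul_le_of_weight hκ h1 (X := A * ((B * s) ^ m / m.factorial))
        (by positivity) (fun p => norm_dyson_le hκ m p h1) n).trans ?_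
      have := hmono m s hs
      simp only [D]
      gcongr
  have hmain := hasDerivAt_tsum_of_isPreconnected (𝕜 := ℝ) (g := fun m s => dyson κ k r m n s)
    (g' := fun m s => -rate n * dyson κ k r m n s - Complex.I * d m s)
    (u := fun m => rate n * (A * ((B * (t + 1)) ^ m / m.factorial) * Real.exp (-|(n : ℝ)|)) + D m)
    (((summable_dyson_majorant _ _ _).mul_left _).add hDs) isOpen_Ioo isPreconnected_Ioo
    (fun m s _ => hd m s)
    (fun m s hs => by
      refine (norm_sub_le _ _).trans (add_le_add ?_ ?_)
      · rw [norm_mul, norm_neg, Complex.norm_real, Real.norm_of_nonneg (rate_pos n).le]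
        refine mul_le_mul_of_nonneg_left ((norm_dyson_le hκ m n hs.1.le).trans ?_) (rate_pos n).le
        have := hmono m s hs
        gcongr
      · rw [norm_mul, Complex.norm_I, one_mul]
        exact hdD m s hs)
    ht1 (summable_norm_dyson hκ n ht.le).of_norm ht1
  refine hmain.congr_deriv ?_
  have hs1 : Summable fun m => d m t :=
    .of_norm (hDs.of_nonneg_of_le (fun _ => norm_nonneg _) fun m => hdD m t ht1)
  rw [((summable_norm_dyson hκ n ht.le).of_norm.mul_left _).tsum_sub (hs1.mul_left _),
    tsum_mul_left, tsum_mul_left, shearMul_density hκ n ht.le, hs1.tsum_eq_zero_add]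
  simp [density, d]

end Dyson

/-! ### Size of the perturbation series -/

section Estimates

variable {κ : ℝ} {k : ℕ → ℕ} {r : ℕ}

/-- The sum of the amplitudes of the shear flow at time `t`. -/
noncomputable def shearBound (κ : ℝ) (k : ℕ → ℕ) (r : ℕ) (t : ℝ) : ℝ :=
  ∑ j ∈ Finset.range r, κ * k j * Real.exp (-(k j : ℝ) ^ 2 * t)

@[fun_prop] lemma continuous_shearBound : Continuous (shearBound κ k r) := by
  unfold shearBound
  fun_prop

lemma norm_dyson_zero (hκ : 0 ≤ κ) (n : ℤ) (t : ℝ) :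
    ‖dyson κ k r 0 n t‖ = ∑ j ∈ Finset.range r, if n.natAbs = k j then
      κ * k j / 2 * Real.exp (-((k j : ℝ) ^ 2 + 1) * t) else 0 := by
  rw [dyson, norm_mul, Complex.norm_real, Complex.norm_real,
    Real.norm_of_nonneg (Real.exp_nonneg _), initCoeff,
    Real.norm_of_nonneg (Finset.sum_nonneg fun _ _ => by split_ifs <;> positivity), Finset.mul_sum]
  refine Finset.sum_congr rfl fun j _ => ?_
  split_ifs with h
  · have : (n : ℝ) ^ 2 = (k j : ℝ) ^ 2 := by
      rw [← h, Nat.cast_natAbs, Int.cast_abs, sq_abs]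
    rw [rate, this, mul_comm]
  · simp

lemma norm_dyson_zero_le (hκ : 0 ≤ κ) (n : ℤ) {t : ℝ} (ht : 0 ≤ t) :
    ‖dyson κ k r 0 n t‖ ≤ shearBound κ k r t := by
  rw [norm_dyson_zero hκ]
  refine Finset.sum_le_sum fun j _ => ?_
  split_ifs
  · gcongr
    · exact half_le_self (by positivity)
    · linarith
  · positivity

lemma norm_shearMul_le_of_bound (hκ : 0 ≤ κ) {f : ℤ → ℝ → ℂ} {t X : ℝ}
    (hf : ∀ n, ‖f n t‖ ≤ X) (n : ℤ) : ‖shearMul κ k r f n t‖ ≤ shearBound κ k r t * X := by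
  refine (norm_shearMul_le hκ f n t).trans ?_
  rw [shearBound, Finset.sum_mul]
  refine Finset.sum_le_sum fun j _ => ?_
  have := amp_nonneg (k := k) hκ j t
  calc _ ≤ amp κ k j t * (X + X) := by gcongr <;> exact hf _
    _ = _ := by rw [amp]; ring

lemma integral_mul_exp_neg (a t : ℝ) : ∫ s in (0 : ℝ)..t, a * Real.exp (-a * s)
    = 1 - Real.exp (-a * t) := by
  have h : ∀ s ∈ Set.uIcc 0 t,
      HasDerivAt (fun s => -Real.exp (-a * s)) (a * Real.exp (-a * s)) s := by
    intro s _
    have h2 : HasDerivAt (fun s : ℝ => Real.exp (-a * s)) (Real.exp (-a * s) * (-a)) s := by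
      simpa using ((hasDerivAt_id s).const_mul (-a)).exp
    exact h2.neg.congr_deriv (by ring)
  rw [intervalIntegral.integral_eq_sub_of_hasDerivAt h
    (Continuous.intervalIntegrable (by fun_prop) _ _)]
  simp
  ring

/-- The shear flow is small in `L¹` in time when its frequencies are large. -/
lemma integral_shearBound_le (hκ : 0 ≤ κ) {K : ℝ} (hK : 0 < K) (hk : ∀ j, K ≤ k j) (t : ℝ) :
    ∫ s in (0 : ℝ)..t, shearBound κ k r s ≤ r * κ / K := by
  have h1 : ∀ j, ∫ s in (0 : ℝ)..t, κ * k j * Real.exp (-(k j : ℝ) ^ 2 * s) ≤ κ / K := by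
    intro j
    have hkj : (0 : ℝ) < k j := hK.trans_le (hk j)
    have h2 : ∀ s : ℝ, κ * k j * Real.exp (-(k j : ℝ) ^ 2 * s)
        = κ / k j * ((k j : ℝ) ^ 2 * Real.exp (-(k j : ℝ) ^ 2 * s)) := fun s => by
      field_simp
    simp only [h2]
    rw [intervalIntegral.integral_const_mul, integral_mul_exp_neg]
    calc _ ≤ κ / k j * 1 := by
          gcongr
          linarith [Real.exp_pos (-(k j : ℝ) ^ 2 * t)]
      _ ≤ κ / K := by rw [mul_one]; exact div_le_div_of_nonneg_left hκ hK (hk j)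
  simp only [shearBound]
  rw [intervalIntegral.integral_finsetSum fun j _ =>
    Continuous.intervalIntegrable (by fun_prop) _ _]
  calc _ ≤ ∑ j ∈ Finset.range r, κ / K := Finset.sum_le_sum fun j _ => h1 j
    _ = _ := by simp; ring

lemma integral_amp_sq (j : ℕ) (t : ℝ) :
    ∫ s in (0 : ℝ)..t, 2 * amp κ k j s ^ 2
      = κ ^ 2 / 4 * (1 - Real.exp (-(2 * (k j : ℝ) ^ 2) * t)) := by
  have h : ∀ s : ℝ, 2 * amp κ k j s ^ 2
      = κ ^ 2 / 4 * (2 * (k j : ℝ) ^ 2 * Real.exp (-(2 * (k j : ℝ) ^ 2) * s)) := by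
    intro s
    rw [amp, mul_pow, ← Real.exp_nat_mul]
    ring_nf
  simp only [h]
  rw [intervalIntegral.integral_const_mul, integral_mul_exp_neg]

/-- The interaction of the shear flow with data of the same size, integrated in time, is bounded
independently of the frequencies. -/
lemma integral_shearBound_sq_le {t : ℝ} (ht : 0 ≤ t) :
    ∫ s in (0 : ℝ)..t, shearBound κ k r s * shearBound κ k r s
      ≤ (r : ℝ) ^ 2 * κ ^ 2 / 2 := by
  have h1 : ∀ s, shearBound κ k r s * shearBound κ k r s
      ≤ 2 * r * ∑ j ∈ Finset.range r, 2 * amp κ k j s ^ 2 := by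
    intro s
    have h2 := sq_sum_le_card_mul_sum_sq (s := Finset.range r)
      (f := fun j => κ * k j * Real.exp (-(k j : ℝ) ^ 2 * s))
    rw [Finset.card_range] at h2
    rw [← sq]
    refine h2.trans_eq ?_
    rw [mul_comm (2 : ℝ), mul_assoc, Finset.mul_sum (a := (2 : ℝ))]
    congr 1
    refine Finset.sum_congr rfl fun j _ => ?_
    rw [amp]
    ring
  refine (intervalIntegral.integral_mono_on ht (Continuous.intervalIntegrable (by fun_prop) _ _)
    (Continuous.intervalIntegrable (by fun_prop) _ _) fun s _ => h1 s).trans ?_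
  rw [intervalIntegral.integral_const_mul, intervalIntegral.integral_finsetSum fun j _ =>
    Continuous.intervalIntegrable (by fun_prop) _ _]
  simp only [integral_amp_sq]
  calc _ ≤ 2 * (r : ℝ) * ∑ j ∈ Finset.range r, κ ^ 2 / 4 := by
        gcongr with j
        refine mul_le_of_le_one_right (by positivity) ?_
        linarith [Real.exp_pos (-(2 * (k j : ℝ) ^ 2) * t)]
    _ = _ := by simp; ring

lemma norm_dyson_succ_le_pow (hκ : 0 ≤ κ) {K : ℝ} (hK : 0 < K) (hk : ∀ j, K ≤ k j) (m : ℕ) (n : ℤ)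
    {t : ℝ} (ht : 0 ≤ t) :
    ‖dyson κ k r (m + 1) n t‖ ≤ (r : ℝ) ^ 2 * κ ^ 2 / 2 * (r * κ / K) ^ m := by
  induction m generalizing n t with
  | zero =>
    refine (norm_dyson_succ_le ht (φ := fun s => shearBound κ k r s * shearBound κ k r s)
      (by fun_prop) fun s hs =>
        norm_shearMul_le_of_bound hκ (fun p => norm_dyson_zero_le hκ p hs.1) n).trans ?_
    simpa using integral_shearBound_sq_le ht
  | succ m ih =>
    refine (norm_dyson_succ_le ht (φ := fun s => shearBound κ k r s *
      ((r : ℝ) ^ 2 * κ ^ 2 / 2 * (r * κ / K) ^ m)) (by fun_prop) fun s hs =>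
        norm_shearMul_le_of_bound hκ (fun p => ih p hs.1) n).trans ?_
    rw [intervalIntegral.integral_mul_const]
    calc _ ≤ (r * κ / K) * ((r : ℝ) ^ 2 * κ ^ 2 / 2 * (r * κ / K) ^ m) := by
          gcongr
          exact integral_shearBound_le hκ hK hk t
      _ = _ := by ring

/-- The interaction of each mode of the shear flow with the same mode of the density transfers an
amount of order `κ²`, whatever the frequency, to the lowest mode; the amounts add up. -/
lemma dyson_one_zero (hk : Function.Injective k) (t : ℝ) :
    dyson κ k r 1 0 t = -Complex.I * ((Real.exp (-t) *
      ∑ j ∈ Finset.range r, κ ^ 2 / 4 * (1 - Real.exp (-(2 * (k j : ℝ) ^ 2) * t)) : ℝ) : ℂ) := by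
  have hinit : ∀ j ∈ Finset.range r, ∀ n : ℤ, n.natAbs = k j →
      initCoeff κ k r n = κ * k j / 2 := by
    intro j hj n hn
    rw [initCoeff, Finset.sum_eq_single_of_mem j hj, if_pos hn]
    intro i _ hij
    rw [if_neg]
    rw [hn]
    exact fun h => hij (hk h).symm
  have hd : ∀ j ∈ Finset.range r, ∀ n : ℤ, n.natAbs = k j → ∀ s,
      dyson κ k r 0 n s = ((Real.exp (-s) * amp κ k j s : ℝ) : ℂ) := by
    intro j hj n hn s
    have hsq : (n : ℝ) ^ 2 = (k j : ℝ) ^ 2 := by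
      rw [← hn, Nat.cast_natAbs, Int.cast_abs, sq_abs]
    rw [dyson, hinit j hj n hn, ← Complex.ofReal_mul, amp, rate, hsq,
      show -((k j : ℝ) ^ 2 + 1) * s = -s + -(k j : ℝ) ^ 2 * s by ring, Real.exp_add]
    congr 1
    ring
  have hint : ∀ s : ℝ, (Real.exp (rate 0 * s) : ℂ) * shearMul κ k r (dyson κ k r 0) 0 s
      = ((∑ j ∈ Finset.range r, 2 * amp κ k j s ^ 2 : ℝ) : ℂ) := by
    intro s
    rw [shearMul, Finset.mul_sum, Complex.ofReal_sum]
    refine Finset.sum_congr rfl fun j hj => ?_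
    rw [hd j hj _ (by simp), hd j hj _ (by simp)]
    have he : Real.exp (rate 0 * s) * Real.exp (-s) = 1 := by
      rw [← Real.exp_add, rate]
      simp
    have he' : (Real.exp (rate 0 * s) : ℂ) * (Real.exp (-s) : ℂ) = 1 := by
      rw [← Complex.ofReal_mul, he, Complex.ofReal_one]
    push_cast at he' ⊢
    linear_combination (2 * (amp κ k j s : ℂ) ^ 2) * he'
  rw [dyson]
  simp only [hint]
  rw [intervalIntegral.integral_ofReal, intervalIntegral.integral_finsetSum fun j _ =>
    Continuous.intervalIntegrable (by fun_prop) _ _]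
  simp only [integral_amp_sq]
  rw [mul_assoc, ← Complex.ofReal_mul]
  congr 4
  simp [rate]

/-- Beyond first order, the lowest mode of the density changes little when the frequencies are
large. -/
lemma norm_density_zero_sub_le (hκ : 0 ≤ κ) {K : ℝ} (hK : 0 < K) (hk : ∀ j, K ≤ k j)
    (hΩ : r * κ / K ≤ 1 / 2) {t : ℝ} (ht : 0 ≤ t) :
    ‖density κ k r 0 t - dyson κ k r 1 0 t‖ ≤ (r : ℝ) ^ 2 * κ ^ 2 * (r * κ / K) := by
  have hs := summable_norm_dyson (k := k) (r := r) hκ 0 ht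
  have hs1 := (summable_nat_add_iff 1).2 hs
  have hs2 := (summable_nat_add_iff 2).2 hs
  have h0 : dyson κ k r 0 0 t = 0 := by
    have : initCoeff κ k r 0 = 0 := by
      refine Finset.sum_eq_zero fun j _ => if_neg ?_
      have : (0 : ℝ) < k j := hK.trans_le (hk j)
      rw [Int.natAbs_zero]
      exact_mod_cast this.ne
    rw [dyson, this]
    simp
  set Ω := r * κ / K
  have hΩ0 : 0 ≤ Ω := by positivity
  have hg : HasSum (fun m : ℕ => (r : ℝ) ^ 2 * κ ^ 2 / 2 * Ω ^ (m + 1))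
      ((r : ℝ) ^ 2 * κ ^ 2 / 2 * (Ω * (1 - Ω)⁻¹)) := by
    simp only [pow_succ']
    exact ((hasSum_geometric_of_lt_one hΩ0 (by linarith)).mul_left _).mul_left _
  rw [density, hs.of_norm.tsum_eq_zero_add, hs1.of_norm.tsum_eq_zero_add, h0, zero_add, zero_add,
    add_sub_cancel_left]
  refine (norm_tsum_le_tsum_norm hs2).trans ((hs2.tsum_le_tsum
    (fun m => norm_dyson_succ_le_pow hκ hK hk (m + 1) 0 ht) hg.summable).trans ?_)
  rw [hg.tsum_eq]
  have h2 : (1 - Ω)⁻¹ ≤ 2 := by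
    rw [inv_le_comm₀ (by linarith) two_pos]
    linarith
  calc _ ≤ (r : ℝ) ^ 2 * κ ^ 2 / 2 * (Ω * 2) := by gcongr
    _ = _ := by ring

/-- Growth of the lowest mode of the density. -/
lemma le_neg_im_density_zero (hκ : 0 ≤ κ) (hinj : Function.Injective k) {K : ℝ} (hK : 0 < K)
    (hk : ∀ j, K ≤ k j) (hΩ : r * κ / K ≤ 1 / 2) {t : ℝ} (ht : 0 ≤ t) (ht1 : t ≤ 1)
    (hKt : 1 ≤ 2 * K ^ 2 * t) :
    κ ^ 2 * r / 24 - (r : ℝ) ^ 2 * κ ^ 2 * (r * κ / K) ≤ -(density κ k r 0 t).im := by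
  have h1 := (Complex.abs_im_le_norm _).trans (norm_density_zero_sub_le hκ hK hk hΩ ht)
  rw [Complex.sub_im, dyson_one_zero hinj] at h1
  have h2 := (abs_le.1 h1).2
  have h3 : κ ^ 2 * r / 24 ≤ Real.exp (-t) *
      ∑ j ∈ Finset.range r, κ ^ 2 / 4 * (1 - Real.exp (-(2 * (k j : ℝ) ^ 2) * t)) := by
    have he : (1 : ℝ) / 3 ≤ Real.exp (-1) := by
      rw [Real.exp_neg, one_div]
      exact inv_anti₀ (Real.exp_pos _) Real.exp_one_lt_three.le
    have he2 : Real.exp (-1) ≤ 1 / 2 := by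
      rw [Real.exp_neg, one_div]
      exact inv_anti₀ two_pos Real.exp_one_gt_two.le
    have ha : (1 : ℝ) / 3 ≤ Real.exp (-t) := he.trans (Real.exp_le_exp.2 (by linarith))
    have hb : (r : ℝ) * (κ ^ 2 / 8) ≤
        ∑ j ∈ Finset.range r, κ ^ 2 / 4 * (1 - Real.exp (-(2 * (k j : ℝ) ^ 2) * t)) := by
      have : ∀ j ∈ Finset.range r,
          κ ^ 2 / 8 ≤ κ ^ 2 / 4 * (1 - Real.exp (-(2 * (k j : ℝ) ^ 2) * t)) := by
        intro j _
        have hk2 : K ^ 2 ≤ (k j : ℝ) ^ 2 := pow_le_pow_left₀ hK.le (hk j) 2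
        have : Real.exp (-(2 * (k j : ℝ) ^ 2) * t) ≤ Real.exp (-1) :=
          Real.exp_le_exp.2 (by nlinarith)
        nlinarith [sq_nonneg κ]
      simpa using Finset.card_nsmul_le_sum _ _ _ this
    calc κ ^ 2 * r / 24 = 1 / 3 * (r * (κ ^ 2 / 8)) := by ring
      _ ≤ _ := by gcongr
  have h4 : ∀ y : ℝ, (-Complex.I * (y : ℂ)).im = -y := fun y => by simp
  rw [h4] at h2
  linarith

end Estimates

/-! ### Shear flow and density in physical space -/

section Fields

variable {κ : ℝ} {k : ℕ → ℕ} {r : ℕ}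

/-- The frequency of `exp (i (n x₁ + x₂))`. -/
noncomputable def freq (n : ℤ) : E3 := (n : ℝ) • unitVec 0 + unitVec 1

@[simp] lemma freq_apply_zero (n : ℤ) : freq n 0 = n := by simp [freq, unitVec_apply]

@[simp] lemma freq_apply_one (n : ℤ) : freq n 1 = 1 := by simp [freq, unitVec_apply]

@[simp] lemma freq_apply_two (n : ℤ) : freq n 2 = 0 := by simp [freq, unitVec_apply]

lemma norm_freq_sq (n : ℤ) : ‖freq n‖ ^ 2 = rate n := by
  rw [EuclideanSpace.norm_sq_eq]
  simp [Fin.sum_univ_three, rate]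

lemma norm_unitVec (i : Fin 3) : ‖unitVec i‖ = 1 := by simp [unitVec]

lemma norm_freq_le (n : ℤ) : ‖freq n‖ ≤ |(n : ℝ)| + 1 := by
  refine (norm_add_le _ _).trans ?_
  simp [norm_smul, norm_unitVec]

lemma freq_add (n m : ℤ) : freq (n + m) = freq n + (m : ℝ) • unitVec 0 := by
  simp only [freq, Int.cast_add, add_smul]
  abel

lemma one_add_norm_freq_le (n m : ℤ) :
    1 + ‖freq n‖ ≤ (1 + |(m : ℝ)|) * (1 + ‖freq (n + m)‖) := by
  have h : freq n = freq (n + m) - (m : ℝ) • unitVec 0 := by rw [freq_add]; abel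
  have h1 : ‖freq n‖ ≤ ‖freq (n + m)‖ + |(m : ℝ)| := by
    rw [h]
    refine (norm_sub_le _ _).trans_eq ?_
    simp [norm_smul, norm_unitVec]
  nlinarith [abs_nonneg (m : ℝ), norm_nonneg (freq (n + m)), mul_nonneg (abs_nonneg (m : ℝ))
    (norm_nonneg (freq (n + m)))]

lemma summable_exp_neg_abs {a : ℝ} (ha : 0 < a) :
    Summable fun n : ℤ => Real.exp (-(a * |(n : ℝ)|)) := by
  have h : Summable fun n : ℕ => Real.exp (n * -a) := by
    rw [Real.summable_exp_nat_mul_iff]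
    linarith
  refine Summable.of_nat_of_neg (h.congr fun n => ?_) (h.congr fun n => ?_) <;>
    · congr 1
      simp
      ring

lemma summable_exp_neg_abs_int : Summable fun n : ℤ => Real.exp (-|(n : ℝ)|) := by
  simpa using summable_exp_neg_abs one_pos

lemma rapidDecay_density (hκ : 0 ≤ κ) (T : ℝ) :
    RapidDecay (Set.Ioo 0 T) freq (density κ k r) := by
  intro j
  have hA : 0 ≤ initSize κ k r := initSize_nonneg hκ
  have hB : 0 ≤ shearSize κ k r := shearSize_nonneg hκ
  refine ⟨fun n => initSize κ k r * Real.exp (shearSize κ k r * T) *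
    (2 ^ j * j.factorial * Real.exp 1) * Real.exp (-((1 / 2 : ℝ) * |(n : ℝ)|)),
    (summable_exp_neg_abs (by norm_num)).mul_left _, fun n t ht => ?_⟩
  have h1 : (1 + ‖freq n‖) ^ j ≤
      2 ^ j * (j.factorial * Real.exp ((2 + |(n : ℝ)|) / 2)) := by
    have h2 := Real.pow_div_factorial_le_exp ((2 + |(n : ℝ)|) / 2) (by positivity) j
    rw [div_le_iff₀ (by positivity)] at h2
    calc (1 + ‖freq n‖) ^ j ≤ (2 * ((2 + |(n : ℝ)|) / 2)) ^ j := by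
          gcongr
          linarith [norm_freq_le n]
      _ = 2 ^ j * ((2 + |(n : ℝ)|) / 2) ^ j := mul_pow _ _ _
      _ ≤ _ := by rw [mul_comm (j.factorial : ℝ)]; gcongr
  have h3 : ‖density κ k r n t‖ ≤
      initSize κ k r * Real.exp (shearSize κ k r * T) * Real.exp (-|(n : ℝ)|) := by
    refine (norm_density_le hκ n ht.1.le).trans ?_
    have := ht.2.le
    gcongr
  have h4 : Real.exp ((2 + |(n : ℝ)|) / 2) * Real.exp (-|(n : ℝ)|)
      = Real.exp 1 * Real.exp (-((1 / 2 : ℝ) * |(n : ℝ)|)) := by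
    rw [← Real.exp_add, ← Real.exp_add]
    ring_nf
  calc _ ≤ 2 ^ j * (j.factorial * Real.exp ((2 + |(n : ℝ)|) / 2)) *
        (initSize κ k r * Real.exp (shearSize κ k r * T) * Real.exp (-|(n : ℝ)|)) := by gcongr
    _ = initSize κ k r * Real.exp (shearSize κ k r * T) * (2 ^ j * j.factorial) *
        (Real.exp ((2 + |(n : ℝ)|) / 2) * Real.exp (-|(n : ℝ)|)) := by ring
    _ = _ := by rw [h4]; ring

lemma SmoothFamily.shearMul {N : ℕ} {T : ℝ} {c : ℤ → ℝ → ℂ}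
    (hc : SmoothFamily (Set.Ioo 0 T) freq N c) :
    SmoothFamily (Set.Ioo 0 T) freq N (shearMul κ k r c) := by
  refine SmoothFamily.sum (c := fun j n t => (amp κ k j t : ℂ) * (c (n - k j) t + c (n + k j) t))
    _ fun j _ => ?_
  have h1 : SmoothFamily (Set.Ioo 0 T) freq N fun n => c (n + k j) :=
    hc.reindex (Equiv.addRight (k j : ℤ)) (one_add_norm_freq_le · (k j))
  have h2 : SmoothFamily (Set.Ioo 0 T) freq N fun n => c (n - k j) := by
    simp only [sub_eq_add_neg]
    exact hc.reindex (Equiv.addRight (-(k j : ℤ))) (one_add_norm_freq_le · (-(k j)))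
  have h3 := ((h2.add h1).exp_mul (fun t ht => ht.1.le) (sq_nonneg (k j : ℝ))).const_mul
    ((κ * k j / 2 : ℝ) : ℂ)
  simp only [amp, Complex.ofReal_mul _ (Real.exp _), mul_assoc]
  exact h3

/-- Parabolic bootstrap: each time derivative of the density is again given by rapidly decaying
coefficients, by its equation. -/
lemma smoothFamily_density (hκ : 0 ≤ κ) (T : ℝ) (N : ℕ) :
    SmoothFamily (Set.Ioo 0 T) freq N (density κ k r) := by
  induction N with
  | zero => exact ⟨rapidDecay_density hκ T, fun n t ht =>
      (hasDerivAt_density hκ n ht.1).continuousAt.continuousWithinAt⟩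
  | succ N ih =>
    refine ⟨rapidDecay_density hκ T, fun n t => -rate n * density κ k r n t
      + -Complex.I * shearMul κ k r (density κ k r) n t, fun n t ht => ?_, ?_⟩
    · refine (hasDerivAt_density hκ n ht.1).congr_deriv ?_
      ring
    · refine (ih.multiplier (m := fun n => -rate n) (D := 1) (p := 2) fun n => ?_).add
        (ih.shearMul.const_mul _)
      rw [norm_neg, Complex.norm_real, Real.norm_of_nonneg (rate_pos n).le, ← norm_freq_sq]
      nlinarith [norm_nonneg (freq n)]

/-- The frequency of the `j`-th mode of the shear flow. -/
noncomputable def shearFreq (k : ℕ → ℕ) (r : ℕ) (j : Fin r) : E3 := (k j : ℝ) • unitVec 0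

/-- The Fourier coefficients of the shear flow. -/
noncomputable def shearCoeff (κ : ℝ) (k : ℕ → ℕ) (r : ℕ) (j : Fin r) (t : ℝ) : ℂ :=
  ((κ * k j : ℝ) : ℂ) * (Real.exp (-(k j : ℝ) ^ 2 * t) : ℂ)

/-- The second component of the velocity. -/
noncomputable def shearField (κ : ℝ) (k : ℕ → ℕ) (r : ℕ) (t : ℝ) (x : E3) : ℝ :=
  (series (shearFreq k r) (fun j => shearCoeff κ k r j t) x).re

/-- The density. -/
noncomputable def densityField (κ : ℝ) (k : ℕ → ℕ) (r : ℕ) (t : ℝ) (x : E3) : ℝ :=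
  (series freq (fun n => density κ k r n t) x).re

lemma norm_shearFreq_sq (j : Fin r) : ‖shearFreq k r j‖ ^ 2 = (k j : ℝ) ^ 2 := by
  rw [shearFreq, norm_smul, norm_unitVec]
  simp

lemma smoothFamily_shearCoeff (T : ℝ) (N : ℕ) :
    SmoothFamily (Set.Ioo 0 T) (shearFreq k r) N (shearCoeff κ k r) :=
  SmoothFamily.of_finite (fun _ ht => ht.1.le) (fun j : Fin r => ((κ * k j : ℝ) : ℂ))
    (μ := fun j => (k j : ℝ) ^ 2) (fun _ => sq_nonneg _) N

lemma shearField_eq (t : ℝ) (x : E3) : shearField κ k r t x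
    = ∑ j ∈ Finset.range r, 2 * amp κ k j t * Real.cos (k j * x 0) := by
  rw [shearField, series, tsum_fintype, Complex.re_sum, Finset.sum_range]
  refine Finset.sum_congr rfl fun j _ => ?_
  have h : inner ℝ (shearFreq k r j) x = k j * x 0 := by
    rw [inner_eq_sum]
    simp [shearFreq, unitVec_apply]
  rw [shearCoeff, wave, h, ← Complex.ofReal_mul, Complex.re_ofReal_mul, Complex.exp_ofReal_mul_I_re,
    amp]
  ring

/-- `shearMul` is multiplication by the shear flow. -/
lemma series_shearMul {c : ℤ → ℝ → ℂ} {t : ℝ} (hc : Summable fun n => ‖c n t‖) (x : E3) :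
    series freq (fun n => shearMul κ k r c n t) x
      = (shearField κ k r t x : ℂ) * series freq (fun n => c n t) x := by
  have hshift : ∀ m : ℤ, HasSum (fun n => c (n + m) t * wave (freq n) x)
      (wave ((-m : ℝ) • unitVec 0) x * series freq (fun n => c n t) x) := by
    intro m
    have h1 := ((Equiv.addRight m).hasSum_iff.2 (summable_series freq hc x).hasSum).mul_left
      (wave ((-m : ℝ) • unitVec 0) x)
    refine (congrArg (HasSum · _) (funext fun n => ?_)).mp h1
    symm
    have h2 : freq n = (-m : ℝ) • unitVec 0 + freq (n + m) := by
      rw [freq_add, neg_smul]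
      abel
    rw [h2, wave_add_left, Function.comp_apply, Equiv.coe_addRight]
    ring
  have hcos : ∀ j : ℕ, wave ((-((k j : ℤ) : ℝ)) • unitVec 0) x
      + wave ((-((-(k j : ℤ) : ℤ) : ℝ)) • unitVec 0) x = 2 * (Real.cos (k j * x 0) : ℂ) := by
    intro j
    have h3 : ∀ a : ℝ, wave (a • unitVec 0) x = Complex.exp (((a * x 0 : ℝ) : ℂ) * Complex.I) := by
      intro a
      rw [wave, inner_eq_sum]
      simp [unitVec_apply]
    rw [h3, h3, Complex.ofReal_cos, Complex.two_cos]
    push_cast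
    ring_nf
  have hsum : HasSum (fun n => shearMul κ k r c n t * wave (freq n) x)
      (∑ j ∈ Finset.range r, (amp κ k j t : ℂ) *
        ((wave ((-((-(k j : ℤ) : ℤ) : ℝ)) • unitVec 0) x) * series freq (fun n => c n t) x
          + wave ((-((k j : ℤ) : ℝ)) • unitVec 0) x * series freq (fun n => c n t) x)) := by
    simp only [shearMul, Finset.sum_mul, mul_assoc, add_mul]
    refine hasSum_sum fun j _ => HasSum.mul_left _ ?_
    have h4 := hshift (-(k j : ℤ))
    simp only [← sub_eq_add_neg] at h4
    exact h4.add (hshift (k j))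
  rw [series, hsum.tsum_eq, shearField_eq, Complex.ofReal_sum, Finset.sum_mul]
  refine Finset.sum_congr rfl fun j _ => ?_
  rw [← add_mul, add_comm (wave _ x), hcos]
  push_cast
  ring

lemma spacePeriodic_shearField (t : ℝ) : SpacePeriodic (shearField κ k r t) :=
  spacePeriodic_series_re (fun j a => by
    fin_cases a
    · exact ⟨k j, by simp [shearFreq, unitVec_apply]⟩
    · exact ⟨0, by simp [shearFreq, unitVec_apply]⟩
    · exact ⟨0, by simp [shearFreq, unitVec_apply]⟩) _

lemma spacePeriodic_densityField (t : ℝ) : SpacePeriodic (densityField κ k r t) :=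
  spacePeriodic_series_re (fun n a => by
    fin_cases a
    · exact ⟨n, by simp⟩
    · exact ⟨1, by simp⟩
    · exact ⟨0, by simp⟩) _

lemma contDiffOn_of_smoothFamily {ι : Type*} {ν : ι → E3} {T : ℝ} {c : ι → ℝ → ℂ}
    (hc : ∀ N, SmoothFamily (Set.Ioo 0 T) ν N c) :
    ContDiffOn ℝ ∞ (fun z : ℝ × E3 => (series ν (fun i => c i z.1) z.2).re)
      (Set.Ioo 0 T ×ˢ Set.univ) :=
  contDiffOn_infty.2 fun N =>
    Complex.reCLM.contDiff.comp_contDiffOn (contDiffOn_series isOpen_Ioo isPreconnected_Ioo (hc N))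

lemma series_zero_coeff {ι : Type*} (ν : ι → E3) (x : E3) : series ν (fun _ => 0) x = 0 := by
  simp [series]

lemma SmoothFamily.laplacian {ι : Type*} {I : Set ℝ} {ν : ι → E3} {N : ℕ} {c : ι → ℝ → ℂ}
    (hc : SmoothFamily I ν N c) :
    SmoothFamily I ν N fun i t => -(‖ν i‖ ^ 2 : ℝ) * c i t :=
  hc.multiplier (D := 1) (p := 2) fun i => by
    rw [norm_neg, Complex.norm_real, Real.norm_of_nonneg (sq_nonneg _)]
    nlinarith [norm_nonneg (ν i)]

lemma series_const_mul {ι : Type*} (ν : ι → E3) (a : ℂ) (c : ι → ℂ) (x : E3) :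
    series ν (fun i => a * c i) x = a * series ν c x := by
  simp only [series, mul_assoc, tsum_mul_left]

lemma series_add {ι : Type*} (ν : ι → E3) {c d : ι → ℂ} (hc : Summable fun i => ‖c i‖)
    (hd : Summable fun i => ‖d i‖) (x : E3) :
    series ν (fun i => c i + d i) x = series ν c x + series ν d x := by
  simp only [series, add_mul]
  exact (summable_series ν hc x).tsum_add (summable_series ν hd x)

lemma hasDerivAt_shearField {t : ℝ} (ht : 0 < t) (x : E3) :
    HasDerivAt (fun τ => shearField κ k r τ x)
      (Laplacian.laplacian (shearField κ k r t) x) t := by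
  have hmem : t ∈ Set.Ioo 0 (t + 1) := ⟨ht, by linarith⟩
  have sw : ∀ N, SmoothFamily (Set.Ioo 0 (t + 1)) (shearFreq k r) N (shearCoeff κ k r) :=
    smoothFamily_shearCoeff _
  have hL := laplacian_series_re isOpen_Ioo isPreconnected_Ioo (sw 2) hmem x
  have hd := hasDerivAt_series_re isOpen_Ioo isPreconnected_Ioo (sw 0).rapidDecay
    (sw 0).laplacian.rapidDecay (fun j t _ => by
      refine ((hasDerivAt_exp_mul (-(k j : ℝ) ^ 2) t).const_mul _).congr_deriv ?_
      rw [norm_shearFreq_sq, shearCoeff]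
      push_cast
      ring) hmem x
  rw [← hL] at hd
  exact hd

lemma hasDerivAt_densityField (hκ : 0 ≤ κ) {t : ℝ} (ht : 0 < t) (x : E3) :
    HasDerivAt (fun τ => densityField κ k r τ x)
      (Laplacian.laplacian (densityField κ k r t) x
        - shearField κ k r t x * fderiv ℝ (densityField κ k r t) x (unitVec 1)) t := by
  have hmem : t ∈ Set.Ioo 0 (t + 1) := ⟨ht, by linarith⟩
  have sd : ∀ N, SmoothFamily (Set.Ioo 0 (t + 1)) freq N (density κ k r) :=
    smoothFamily_density hκ _
  have hL := laplacian_series_re isOpen_Ioo isPreconnected_Ioo (sd 2) hmem x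
  have h1 := fderiv_series_re isOpen_Ioo isPreconnected_Ioo (sd 1) hmem x 1
  have hm := (sd 0).laplacian
  have hm2 := ((sd 0).shearMul (κ := κ) (k := k) (r := r)).const_mul (-Complex.I)
  have hd := hasDerivAt_series_re isOpen_Ioo isPreconnected_Ioo (sd 0).rapidDecay
    (hm.add hm2).rapidDecay (fun n t ht => by
      refine (hasDerivAt_density hκ n ht.1).congr_deriv ?_
      rw [norm_freq_sq]
      ring) hmem x
  refine hd.congr_deriv ?_
  have hsum := (sd 0).rapidDecay.summable_norm hmem
  have h2 : series freq (fun n => -(‖freq n‖ ^ 2 : ℝ) * density κ k r n t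
      + -Complex.I * shearMul κ k r (density κ k r) n t) x
      = series freq (fun n => -(‖freq n‖ ^ 2 : ℝ) * density κ k r n t) x
        + -Complex.I * ((shearField κ k r t x : ℂ) *
          series freq (fun n => density κ k r n t) x) := by
    rw [← series_shearMul hsum, ← series_const_mul, ← series_add freq
      (hm.rapidDecay.summable_norm hmem) (hm2.rapidDecay.summable_norm hmem)]
  have h3 : series freq (fun n => Complex.I * (freq n 1 : ℂ) * density κ k r n t) x
      = Complex.I * series freq (fun n => density κ k r n t) x := by
    simp only [freq_apply_one, Complex.ofReal_one, mul_one]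
    exact series_const_mul _ _ _ _
  rw [h3] at h1
  rw [h2, Complex.add_re, ← hL, neg_mul, mul_left_comm, Complex.neg_re, Complex.re_ofReal_mul,
    ← h1, sub_eq_add_neg]
  rfl

lemma fderiv_shearField {t : ℝ} (ht : 0 < t) (x : E3) {a : Fin 3} (ha : a ≠ 0) :
    fderiv ℝ (shearField κ k r t) x (unitVec a) = 0 := by
  have h := fderiv_series_re isOpen_Ioo isPreconnected_Ioo
    (smoothFamily_shearCoeff (κ := κ) (k := k) (r := r) (t + 1) 1) ⟨ht, by linarith⟩ x a
  have h0 : ∀ j, shearFreq k r j a = 0 := fun j => by simp [shearFreq, unitVec_apply, ha]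
  simp only [h0, Complex.ofReal_zero, mul_zero, zero_mul, series_zero_coeff, Complex.zero_re] at h
  exact h

lemma fderiv_densityField_two (hκ : 0 ≤ κ) {t : ℝ} (ht : 0 < t) (x : E3) :
    fderiv ℝ (densityField κ k r t) x (unitVec 2) = 0 := by
  have h := fderiv_series_re isOpen_Ioo isPreconnected_Ioo
    (smoothFamily_density (k := k) (r := r) hκ (t + 1) 1) ⟨ht, by linarith⟩ x 2
  simp only [freq_apply_two, Complex.ofReal_zero, mul_zero, zero_mul, series_zero_coeff,
    Complex.zero_re] at h
  exact h

/-- Translation in time by `δ > 0` moves smoothness on an open time interval to a closed one. -/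
lemma contDiffOn_time_shift {f : ℝ → E3 → ℝ} {T δ : ℝ} (hδ : 0 < δ)
    (h : ContDiffOn ℝ ∞ (fun z : ℝ × E3 => f z.1 z.2) (Set.Ioo 0 (T + δ + 1) ×ˢ Set.univ)) :
    ContDiffOn ℝ ∞ (fun z : ℝ × E3 => f (z.1 + δ) z.2) (Set.Icc 0 T ×ˢ Set.univ) := by
  have hshift : ContDiff ℝ ∞ fun z : ℝ × E3 => (z.1 + δ, z.2) := by fun_prop
  have hmaps : Set.MapsTo (fun z : ℝ × E3 => (z.1 + δ, z.2)) (Set.Icc 0 T ×ˢ Set.univ)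
      (Set.Ioo 0 (T + δ + 1) ×ˢ Set.univ) := by
    rintro z ⟨⟨h0, h1⟩, -⟩
    exact ⟨⟨by linarith, by linarith⟩, trivial⟩
  exact h.comp hshift.contDiffOn hmaps

/-- The shear flow and the density it advects give a solution. Its initial time is a positive time
`δ` of the perturbation series, which makes it smooth on an open set of times. -/
theorem isSmoothPeriodicSolution_shearField (hκ : 0 ≤ κ) {T δ : ℝ} (hT : 0 < T) (hδ : 0 < δ) :
    IsSmoothPeriodicSolution T
      (fun t x => shearField κ k r (t + δ) x • unitVec 1
        + (t * densityField κ k r (t + δ) x) • unitVec 2)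
      (fun t => densityField κ k r (t + δ)) (fun _ _ => 0) := by
  have hpos : ∀ t ∈ Set.Icc 0 T, 0 < t + δ := fun t ht => by linarith [ht.1]
  exact isSmoothPeriodicSolution_of_shear hT (w := fun t => shearField κ k r (t + δ))
    (ρ := fun t => densityField κ k r (t + δ))
    (contDiffOn_time_shift hδ (contDiffOn_of_smoothFamily (smoothFamily_shearCoeff _)))
    (contDiffOn_time_shift hδ (contDiffOn_of_smoothFamily (smoothFamily_density hκ _)))
    (fun t _ => spacePeriodic_shearField _) (fun t _ => spacePeriodic_densityField _)
    (fun t ht x => (hasDerivAt_shearField (hpos t ht) x).comp_add_const t δ)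
    (fun t ht x => (hasDerivAt_densityField hκ (hpos t ht) x).comp_add_const t δ)
    (fun t ht x => fderiv_shearField (hpos t ht) x (by decide))
    (fun t ht x => fderiv_shearField (hpos t ht) x (by decide))
    (fun t ht x => fderiv_densityField_two hκ (hpos t ht) x)

end Fields

/-! ### Besov norms of the data and of the solution -/

section Norms

variable {κ : ℝ} {r : ℕ}

/-- A lacunary sequence of frequencies. -/
def lacunary (K : ℕ) (j : ℕ) : ℕ := K * 2 ^ j

lemma lacunary_injective {K : ℕ} (hK : 0 < K) : Function.Injective (lacunary K) := by
  intro i j h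
  exact Nat.pow_right_injective le_rfl (Nat.eq_of_mul_eq_mul_left hK h)

lemma le_lacunary (K j : ℕ) : (K : ℝ) ≤ lacunary K j := by
  exact_mod_cast Nat.le_mul_of_pos_right K (by positivity)

/-- The left side is at most `f (2 y) - f y` with `f y = 4 y / (1 + y)`, so that its sum over a
dyadic sequence telescopes. -/
lemma mul_exp_neg_sq_le {y : ℝ} (hy : 0 ≤ y) :
    y * Real.exp (-y ^ 2) ≤ 4 * (2 * y) / (1 + 2 * y) - 4 * y / (1 + y) := by
  have h1 : 1 + y ^ 2 ≤ Real.exp (y ^ 2) := by linarith [Real.add_one_le_exp (y ^ 2)]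
  have h2 : Real.exp (-y ^ 2) ≤ 1 / (1 + y ^ 2) := by
    rw [Real.exp_neg, ← one_div]
    exact one_div_le_one_div_of_le (by positivity) h1
  have h3 : 4 * (2 * y) / (1 + 2 * y) - 4 * y / (1 + y) = y * (4 / ((1 + 2 * y) * (1 + y))) := by
    field_simp
    ring
  rw [h3]
  refine mul_le_mul_of_nonneg_left (h2.trans ?_) hy
  rw [div_le_div_iff₀ (by positivity) (by positivity)]
  nlinarith [sq_nonneg (y - 1)]

/-- The Besov norm of a lacunary sum is bounded independently of the number of its terms. -/
lemma sum_lacunary_le (hκ : 0 ≤ κ) (K : ℕ) {t : ℝ} (ht : 0 < t) :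
    t ^ ((1 : ℝ) / 2) * ∑ j ∈ Finset.range r, κ * lacunary K j *
      Real.exp (-(lacunary K j : ℝ) ^ 2 * t) ≤ 4 * κ := by
  rw [← Real.sqrt_eq_rpow]
  set y : ℕ → ℝ := fun j => Real.sqrt t * lacunary K j with hy
  have hy0 : ∀ j, 0 ≤ y j := fun j => by positivity
  have hy2 : ∀ j, y (j + 1) = 2 * y j := fun j => by
    simp only [hy, lacunary]
    push_cast
    ring
  calc _ = κ * ∑ j ∈ Finset.range r, y j * Real.exp (-y j ^ 2) := by
        rw [Finset.mul_sum, Finset.mul_sum]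
        refine Finset.sum_congr rfl fun j _ => ?_
        simp only [hy]
        rw [mul_pow, Real.sq_sqrt ht.le]
        ring_nf
    _ ≤ κ * ∑ j ∈ Finset.range r, (4 * y (j + 1) / (1 + y (j + 1)) - 4 * y j / (1 + y j)) := by
        gcongr with j
        rw [hy2]
        exact mul_exp_neg_sq_le (hy0 j)
    _ ≤ κ * 4 := by
        gcongr
        rw [Finset.sum_range_sub (fun j => 4 * y j / (1 + y j))]
        have h1 : 4 * y r / (1 + y r) ≤ 4 := by
          rw [div_le_iff₀ (by linarith [hy0 r])]
          linarith
        have h2 : 0 ≤ 4 * y 0 / (1 + y 0) := by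
          have := hy0 0
          positivity
        linarith
    _ = _ := mul_comm _ _

lemma abs_heat_series_re_le {ι : Type*} [Countable ι] (ν : ι → E3) {c : ι → ℂ}
    (hc : Summable fun i => ‖c i‖) {t : ℝ} (ht : 0 < t) (x : E3) :
    |heat t (fun y => (series ν c y).re) x| ≤ ∑' i, ‖c i‖ * Real.exp (-t * ‖ν i‖ ^ 2) := by
  rw [heat_series_re ν hc ht]
  refine (Complex.abs_re_le_norm _).trans ((norm_series_le ν (summable_heat_coeff ν hc ht) x).trans
    (le_of_eq (tsum_congr fun i => ?_)))
  rw [norm_mul, Complex.norm_real, Real.norm_of_nonneg (Real.exp_nonneg _)]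

lemma heat_smul_const {F : Type*} [NormedAddCommGroup F] [NormedSpace ℝ F] [CompleteSpace F]
    (t : ℝ) (f : E3 → ℝ) (v : F) (x : E3) :
    heat t (fun y => f y • v) x = heat t f x • v := by
  simp only [heat_eq]
  rw [← integral_smul_const]
  simp only [smul_assoc]

lemma besovNorm_shearField_le (hκ : 0 ≤ κ) (K : ℕ) {δ : ℝ} (hδ : 0 ≤ δ) :
    besovNorm 1 (fun x => shearField κ (lacunary K) r δ x • unitVec 1)
      ≤ ENNReal.ofReal (4 * κ) := by
  refine besovNorm_le_of_forall fun t ht x => ?_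
  rw [heat_smul_const, norm_smul, norm_unitVec, mul_one, Real.norm_eq_abs]
  refine le_trans ?_ (sum_lacunary_le (r := r) hκ K ht)
  refine mul_le_mul_of_nonneg_left ?_ (Real.rpow_nonneg ht.le _)
  have h := abs_heat_series_re_le (shearFreq (lacunary K) r)
    (c := fun j => shearCoeff κ (lacunary K) r j δ) .of_finite ht x
  refine h.trans ?_
  rw [tsum_fintype, Finset.sum_range]
  refine Finset.sum_le_sum fun j _ => ?_
  rw [norm_shearFreq_sq, shearCoeff, norm_mul, Complex.norm_real, Complex.norm_real,
    Real.norm_of_nonneg (by positivity), Real.norm_of_nonneg (Real.exp_nonneg _),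
    mul_comm (-t), mul_neg, ← neg_mul]
  refine mul_le_mul_of_nonneg_right (mul_le_of_le_one_right (by positivity)
    (Real.exp_le_one_iff.2 ?_)) (Real.exp_nonneg _)
  nlinarith [mul_nonneg hδ (sq_nonneg (lacunary K j : ℝ))]

lemma hasSum_natAbs_eq {k : ℕ} (hk : 0 < k) (a : ℝ) :
    HasSum (fun n : ℤ => if n.natAbs = k then a else 0) (a + a) := by
  have h := (hasSum_ite_eq (k : ℤ) a).add (hasSum_ite_eq (-(k : ℤ)) a)
  refine (congrArg (HasSum · _) (funext fun n => ?_)).mp h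
  by_cases h1 : n = k
  · have h2 : ¬ n = -(k : ℤ) := by omega
    have h3 : n.natAbs = k := by omega
    rw [if_pos h1, if_neg h2, if_pos h3, add_zero]
  · by_cases h2 : n = -(k : ℤ)
    · have h3 : n.natAbs = k := by omega
      rw [if_neg h1, if_pos h2, if_pos h3, zero_add]
    · have h3 : ¬ n.natAbs = k := by omega
      rw [if_neg h1, if_neg h2, if_neg h3, zero_add]

lemma summable_norm_density (hκ : 0 ≤ κ) (k : ℕ → ℕ) {t : ℝ} (ht : 0 < t) :
    Summable fun n => ‖density κ k r n t‖ :=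
  (rapidDecay_density hκ (t + 1)).summable_norm ⟨ht, by linarith⟩

/-- The Besov norm of the density at a small time `δ`: the free part is controlled by lacunarity,
and the rest tends to zero with `δ`. -/
lemma besovNorm_densityField_le (hκ : 0 ≤ κ) {K : ℕ} (hK : 0 < K) {δ : ℝ} (hδ : 0 < δ) :
    besovNorm 1 (densityField κ (lacunary K) r δ) ≤ ENNReal.ofReal (4 * κ +
      initSize κ (lacunary K) r * (Real.exp (shearSize κ (lacunary K) r * δ) - 1) *
        ∑' n : ℤ, Real.exp (-|(n : ℝ)|)) := by
  set E := initSize κ (lacunary K) r * (Real.exp (shearSize κ (lacunary K) r * δ) - 1)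
  have hE : 0 ≤ E := by
    refine mul_nonneg (initSize_nonneg hκ) (sub_nonneg.2 (Real.one_le_exp ?_))
    exact mul_nonneg (shearSize_nonneg hκ) hδ.le
  refine besovNorm_le_of_forall fun t ht x => ?_
  have hs := summable_norm_density (r := r) hκ (lacunary K) hδ
  have h1 := abs_heat_series_re_le freq hs ht x
  have hfree : HasSum (fun n : ℤ => ∑ j ∈ Finset.range r, if n.natAbs = lacunary K j then
      κ * lacunary K j / 2 * Real.exp (-(lacunary K j : ℝ) ^ 2 * t) else 0)
      (∑ j ∈ Finset.range r, κ * lacunary K j * Real.exp (-(lacunary K j : ℝ) ^ 2 * t)) := by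
    refine hasSum_sum fun j _ => ?_
    have := hasSum_natAbs_eq (k := lacunary K j) (Nat.mul_pos hK (by positivity))
      (κ * lacunary K j / 2 * Real.exp (-(lacunary K j : ℝ) ^ 2 * t))
    convert this using 1
    ring
  have herr := (summable_exp_neg_abs_int.hasSum.mul_left E).mul_right (Real.exp (-t))
  have hterm : ∀ n : ℤ, ‖density κ (lacunary K) r n δ‖ * Real.exp (-t * ‖freq n‖ ^ 2)
      ≤ (∑ j ∈ Finset.range r, if n.natAbs = lacunary K j then
      κ * lacunary K j / 2 * Real.exp (-(lacunary K j : ℝ) ^ 2 * t) else 0)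
        + E * Real.exp (-|(n : ℝ)|) * Real.exp (-t) := by
    intro n
    have h2 : ‖density κ (lacunary K) r n δ‖ ≤ ‖dyson κ (lacunary K) r 0 n δ‖
        + E * Real.exp (-|(n : ℝ)|) := by
      have h3 := norm_density_sub_le (k := lacunary K) (r := r) hκ n hδ.le
      have h4 := norm_add_le (dyson κ (lacunary K) r 0 n δ)
        (density κ (lacunary K) r n δ - dyson κ (lacunary K) r 0 n δ)
      rw [add_sub_cancel] at h4
      linarith
    refine (mul_le_mul_of_nonneg_right h2 (Real.exp_nonneg _)).trans ?_
    rw [add_mul, norm_freq_sq]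
    refine add_le_add ?_ ?_
    · rw [norm_dyson_zero hκ, Finset.sum_mul]
      refine Finset.sum_le_sum fun j _ => ?_
      split_ifs with h
      · have hsq : (n : ℝ) ^ 2 = (lacunary K j : ℝ) ^ 2 := by
          rw [← h, Nat.cast_natAbs, Int.cast_abs, sq_abs]
        rw [mul_assoc, ← Real.exp_add, rate, hsq]
        gcongr
        nlinarith [mul_nonneg hδ.le (sq_nonneg (lacunary K j : ℝ))]
      · simp
    · gcongr
      rw [rate]
      nlinarith [mul_nonneg ht.le (sq_nonneg (n : ℝ))]
  have h5 : |heat t (densityField κ (lacunary K) r δ) x| ≤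
      (∑ j ∈ Finset.range r, κ * lacunary K j * Real.exp (-(lacunary K j : ℝ) ^ 2 * t))
        + E * (∑' n : ℤ, Real.exp (-|(n : ℝ)|)) * Real.exp (-t) := by
    refine h1.trans ?_
    have hsum := hfree.add herr
    rw [← hsum.tsum_eq]
    refine Summable.tsum_le_tsum hterm (hsum.summable.of_nonneg_of_le (fun _ => by positivity)
      hterm) hsum.summable
  have h6 : t ^ ((1 : ℝ) / 2) * Real.exp (-t) ≤ 1 := by
    rw [← Real.sqrt_eq_rpow, Real.exp_neg, ← div_eq_mul_inv, div_le_one (Real.exp_pos _)]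
    have h7 : Real.sqrt t ≤ t + 1 := by
      nlinarith [Real.sq_sqrt ht.le, sq_nonneg (Real.sqrt t - 1), Real.sqrt_nonneg t]
    exact h7.trans (Real.add_one_le_exp t)
  have hS : 0 ≤ ∑' n : ℤ, Real.exp (-|(n : ℝ)|) := tsum_nonneg fun _ => (Real.exp_pos _).le
  calc _ ≤ t ^ ((1 : ℝ) / 2) * ((∑ j ∈ Finset.range r, κ * lacunary K j *
          Real.exp (-(lacunary K j : ℝ) ^ 2 * t))
        + E * (∑' n : ℤ, Real.exp (-|(n : ℝ)|)) * Real.exp (-t)) := by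
        rw [Real.norm_eq_abs]
        gcongr
    _ = t ^ ((1 : ℝ) / 2) * (∑ j ∈ Finset.range r, κ * lacunary K j *
          Real.exp (-(lacunary K j : ℝ) ^ 2 * t))
        + E * (∑' n : ℤ, Real.exp (-|(n : ℝ)|)) * (t ^ ((1 : ℝ) / 2) * Real.exp (-t)) := by ring
    _ ≤ 4 * κ + E * (∑' n : ℤ, Real.exp (-|(n : ℝ)|)) * 1 := by
        exact add_le_add (sum_lacunary_le hκ K ht) (by gcongr)
    _ = _ := by rw [mul_one]

lemma wave_freq_apply (n : ℤ) (θ : ℝ) :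
    wave (freq n) (θ • unitVec 0 + (Real.pi / 2) • unitVec 1)
      = Complex.exp ((n * Complex.I) * θ) * Complex.I := by
  have h : inner ℝ (freq n) (θ • unitVec 0 + (Real.pi / 2) • unitVec 1)
      = n * θ + Real.pi / 2 := by
    rw [inner_eq_sum]
    simp [Fin.sum_univ_three, unitVec_apply]
  rw [wave, h]
  push_cast
  rw [add_mul, Complex.exp_add, Complex.exp_pi_div_two_mul_I]
  ring_nf

lemma integral_exp_int_mul {n : ℤ} (hn : n ≠ 0) :
    ∫ θ in (0 : ℝ)..2 * Real.pi, Complex.exp ((n * Complex.I) * θ) = 0 := by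
  rw [integral_exp_mul_complex (mul_ne_zero (by exact_mod_cast hn) Complex.I_ne_zero)]
  have : Complex.exp (n * Complex.I * ((2 * Real.pi : ℝ) : ℂ)) = 1 :=
    Complex.exp_eq_one_iff.2 ⟨n, by push_cast; ring⟩
  rw [this]
  simp

/-- A bound on a density bounds its lowest Fourier mode: average over `x₁` at `x₂ = π / 2`. -/
lemma abs_im_coeff_zero_le {c : ℤ → ℂ} (hc : Summable fun n => ‖c n‖) {L : ℝ}
    (hL : ∀ x, |(series freq c x).re| ≤ L) : |(c 0).im| ≤ L := by
  let p : ℝ → E3 := fun θ => θ • unitVec 0 + (Real.pi / 2) • unitVec 1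
  have hp : Continuous p := by fun_prop
  have hpi : (0 : ℝ) < 2 * Real.pi := by positivity
  have hsum : HasSum (fun n => ∫ θ in (0 : ℝ)..2 * Real.pi, c n * wave (freq n) (p θ))
      (∫ θ in (0 : ℝ)..2 * Real.pi, series freq c (p θ)) := by
    refine intervalIntegral.hasSum_integral_of_dominated_convergence (fun n _ => ‖c n‖)
      (fun n => ?_) (fun n => .of_forall fun θ _ => by simp) (.of_forall fun _ _ => hc) (by simp)
      (.of_forall fun θ _ => (summable_series freq hc (p θ)).hasSum)
    exact Continuous.aestronglyMeasurable (by fun_prop)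
  have hterm : ∀ n : ℤ, ∫ θ in (0 : ℝ)..2 * Real.pi, c n * wave (freq n) (p θ)
      = if n = 0 then 2 * Real.pi * Complex.I * c 0 else 0 := by
    intro n
    simp only [p, wave_freq_apply]
    rw [intervalIntegral.integral_const_mul, intervalIntegral.integral_mul_const]
    split_ifs with h
    · subst h
      simp
      ring
    · rw [integral_exp_int_mul h]
      simp
  simp only [hterm] at hsum
  have h1 := hsum.unique (hasSum_ite_eq 0 _)
  have hcont : Continuous fun θ => series freq c (p θ) := (continuous_series freq hc).comp hp
  have h2 : ∫ θ in (0 : ℝ)..2 * Real.pi, (series freq c (p θ)).re = -(2 * Real.pi * (c 0).im) := by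
    have h3 := Complex.reCLM.intervalIntegral_comp_comm (μ := volume)
      (hcont.intervalIntegrable 0 (2 * Real.pi))
    simp only [Complex.reCLM_apply] at h3
    rw [h3, h1]
    simp
  have h4 := intervalIntegral.norm_integral_le_of_norm_le_const
    (f := fun θ => (series freq c (p θ)).re) (a := 0) (b := 2 * Real.pi) (C := L)
    fun θ _ => hL (p θ)
  rw [h2, sub_zero, abs_of_pos hpi, Real.norm_eq_abs, abs_neg, abs_mul, abs_of_pos hpi,
    mul_comm] at h4
  exact le_of_mul_le_mul_right h4 hpi

/-- The lowest mode of the density bounds all its Besov norms from below. -/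
lemma lt_besovNorm_densityField (hκ : 0 ≤ κ) (k : ℕ → ℕ) {t L : ℝ} (ht : 0 < t) (hL0 : 0 ≤ L)
    (hL : L < Real.exp (-1) * -(density κ k r 0 t).im) (s : ℝ) :
    ENNReal.ofReal L < besovNorm s (densityField κ k r t) := by
  have hs := summable_norm_density (r := r) hκ k ht
  have hs1 := summable_heat_coeff freq hs one_pos
  have hheat := fun x => heat_series_re freq hs one_pos x
  by_contra! hcon
  have hcont : Continuous (heat 1 (densityField κ k r t)) := by
    have : heat 1 (densityField κ k r t) = _ := funext hheat
    rw [this]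
    exact Complex.continuous_re.comp (continuous_series freq hs1)
  have hb : ∀ x, |(series freq
      (fun n => density κ k r n t * (Real.exp (-1 * ‖freq n‖ ^ 2) : ℂ)) x).re| ≤ L := by
    intro x
    rw [← hheat x, ← ENNReal.ofReal_le_ofReal_iff hL0]
    exact (le_besovNorm_of_continuous s hcont x).trans hcon
  have h := abs_im_coeff_zero_le hs1 hb
  rw [norm_freq_sq, Complex.im_mul_ofReal, rate] at h
  norm_num at h
  nlinarith [neg_le_abs (density κ k r 0 t).im, Real.exp_pos (-1)]

end Norms

end Boussinesq

theorem theorem1p1 :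
    ∃ ε₀ : ℝ, 0 < ε₀ ∧ ∀ ε : ℝ, 0 < ε → ε < ε₀ →
      ∃ (T : ℝ) (u : ℝ → Boussinesq.E3 → Boussinesq.E3) (ρ : ℝ → Boussinesq.E3 → ℝ)
        (p : ℝ → Boussinesq.E3 → ℝ),
        0 < T ∧ T < ε ∧
        Boussinesq.IsSmoothPeriodicSolution T u ρ p ∧
        Boussinesq.besovNorm 1 (u 0) + Boussinesq.besovNorm 1 (ρ 0) < ENNReal.ofReal ε ∧
        ∀ s : ℝ, 0 < s → ENNReal.ofReal (1 / ε) < Boussinesq.besovNorm s (ρ T) := by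
  refine ⟨1, one_pos, fun ε hε hε1 => ?_⟩
  -- both initial norms are at most `4 κ` up to a small error, so `8 κ = ε / 2` leaves room for it
  obtain ⟨κ, hκdef⟩ : ∃ κ : ℝ, κ = ε / 16 := ⟨_, rfl⟩
  have hκ : 0 < κ := by rw [hκdef]; positivity
  -- the number `r` of modes makes the first-order growth of the lowest mode large
  obtain ⟨r, hr⟩ := exists_nat_gt (24 * (4 / ε) / κ ^ 2)
  have hr' : 4 / ε < κ ^ 2 * r / 24 := by
    rw [div_lt_iff₀ (by positivity)] at hr
    linarith
  -- the base frequency `K` makes the higher-order terms small and lets the growth happen by `ε / 2`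
  obtain ⟨K, hK⟩ := exists_nat_ge (1 + 2 / ε + 2 * (r * κ) + r ^ 2 * κ ^ 2 * (r * κ) * ε)
  have e1 : 0 < 2 / ε := by positivity
  have e2 : 0 ≤ 2 * (r * κ) := by positivity
  have e3 : 0 ≤ r ^ 2 * κ ^ 2 * (r * κ) * ε := by positivity
  have hK0 : (0 : ℝ) < K := by linarith
  have hKpos : 0 < K := by exact_mod_cast hK0
  have hΩ : r * κ / K ≤ 1 / 2 := by
    rw [div_le_iff₀ hK0]
    linarith
  have hR : (r : ℝ) ^ 2 * κ ^ 2 * (r * κ / K) ≤ 1 / ε := by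
    rw [le_div_iff₀ hε, ← mul_div_assoc, div_mul_eq_mul_div, div_le_one hK0]
    linarith
  have hKε : 2 ≤ K * ε := by
    have : 2 / ε ≤ K := by linarith
    rwa [div_le_iff₀ hε] at this
  -- the starting time `δ` makes the initial data close to the free heat flow
  obtain ⟨δ, hδ, hδε, hE⟩ : ∃ δ : ℝ, 0 < δ ∧ δ < ε / 2 ∧
      Boussinesq.initSize κ (Boussinesq.lacunary K) r *
        (Real.exp (Boussinesq.shearSize κ (Boussinesq.lacunary K) r * δ) - 1) *
        ∑' n : ℤ, Real.exp (-|(n : ℝ)|) < ε / 2 := by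
    have hcont : Continuous fun δ : ℝ => Boussinesq.initSize κ (Boussinesq.lacunary K) r *
        (Real.exp (Boussinesq.shearSize κ (Boussinesq.lacunary K) r * δ) - 1) *
        ∑' n : ℤ, Real.exp (-|(n : ℝ)|) := by fun_prop
    have h1 := (hcont.tendsto 0).eventually_lt_const (u := ε / 2) (by simpa using hε)
    have h2 := (h1.filter_mono nhdsWithin_le_nhds).and
      (Ioo_mem_nhdsGT (show (0 : ℝ) < ε / 2 by positivity))
    obtain ⟨δ, hδ1, hδ2⟩ := h2.exists
    exact ⟨δ, hδ2.1, hδ2.2, hδ1⟩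
  refine ⟨ε / 2, _, _, _, by positivity, by linarith,
    Boussinesq.isSmoothPeriodicSolution_shearField (k := Boussinesq.lacunary K) (r := r) hκ.le
      (by positivity) hδ, ?_, fun s _ => ?_⟩
  · simp only [zero_add, zero_mul, zero_smul, add_zero]
    refine (add_le_add (Boussinesq.besovNorm_shearField_le hκ.le K hδ.le)
      (Boussinesq.besovNorm_densityField_le hκ.le hKpos hδ)).trans_lt ?_
    have hE0 : 0 ≤ Boussinesq.initSize κ (Boussinesq.lacunary K) r *
        (Real.exp (Boussinesq.shearSize κ (Boussinesq.lacunary K) r * δ) - 1) *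
        ∑' n : ℤ, Real.exp (-|(n : ℝ)|) := by
      refine mul_nonneg (mul_nonneg (Boussinesq.initSize_nonneg hκ.le) (sub_nonneg.2
        (Real.one_le_exp (mul_nonneg (Boussinesq.shearSize_nonneg hκ.le) hδ.le))))
        (tsum_nonneg fun _ => (Real.exp_pos _).le)
    rw [← ENNReal.ofReal_add (by positivity) (by positivity)]
    refine (ENNReal.ofReal_lt_ofReal_iff hε).2 ?_
    linarith
  · refine Boussinesq.lt_besovNorm_densityField hκ.le _ (by positivity) (by positivity) ?_ s
    have hgrow := Boussinesq.le_neg_im_density_zero (r := r) hκ.le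
      (Boussinesq.lacunary_injective hKpos) hK0 (Boussinesq.le_lacunary K) hΩ
      (t := ε / 2 + δ) (by positivity) (by linarith) (by
        have h1 : (1 : ℝ) ≤ K := by linarith
        nlinarith [mul_nonneg hK0.le hδ.le, mul_nonneg hK0.le (mul_nonneg hK0.le hδ.le),
          mul_le_mul h1 hKε (by norm_num) hK0.le])
    have he : (1 : ℝ) / 3 < Real.exp (-1) := by
      rw [Real.exp_neg, one_div]
      exact inv_strictAnti₀ (Real.exp_pos _) Real.exp_one_lt_three
    have h4 : 4 / ε = 4 * (1 / ε) := by ring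
    have hpos : 0 < 1 / ε := by positivity
    have hbig : 3 * (1 / ε) <
        -(Boussinesq.density κ (Boussinesq.lacunary K) r 0 (ε / 2 + δ)).im := by
      linarith
    nlinarith
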